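/- **Setting.** Let $f:\mathbb{R}^n\to\mathbb{R}\cup\{+\infty\}$ and $g:\mathbb{R}^m\to\mathbb{R}\cup\{+\infty\}$ be proper, closed and convex, and let $A\in\mathbb{R}^{m\times n}$, $A\neq 0$. Put $P(x)=f(x)+g(Ax)$, $P^\star=\inf_x P(x)$ and $D(y)=-f^*(-A^\top y)-g^*(y)$; let $\mathcal{X}^\star$ be the set of minimizers of $P$ and $\mathcal{Y}^\star$ the set of maximizers of $D$. Let $\|x\|_{\mathcal X}=\|S_{\mathcal X}x\|_2$ and $\|y\|_{\mathcal Y}=\|S_{\mathcal Y}y\|_2$ be weighted (semi-)norms given by matrices $S_{\mathcal X},S_{\mathcal Y}$, with dual (semi-)norms $\|u\|_{*}=\sup\{\langle u,v\rangle:\|v\|\le 1\}$, and assume that $\bar L_A:=\sup\{\|Ax\|_{\mathcal Y,*}^2:\|x\|_{\mathcal X}\le1\}$ is finite (this is automatic for norms). Let $p_{\mathcal X}:\mathbb{R}^n\to\mathbb{R}$ and $p_{\mathcal Y}:\mathbb{R}^m\to\mathbb{R}$ be differentiable and $1$-strongly convex with respect to $\|\cdot\|_{\mathcal X}$, resp.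 $\|\cdot\|_{\mathcal Y}$, with gradients that are Lipschitz from the (semi-)norm to its dual with constants $L_{b_{\mathcal X}}=1$ and $L_{b_{\mathcal Y}}\ge1$. Let $b_{\mathcal X},b_{\mathcal Y}$ be their Bregman distances, $b(z,\dot z)=p(z)-p(\dot z)-\langle\nabla p(\dot z),z-\dot z\rangle$, and let $\dot x\in\mathbb{R}^n$, $\dot y\in\mathbb{R}^m$. **Algorithm (ADSGARD).** Let $\gamma_1>0$, $\beta_1=\bar L_A/\gamma_1$, $\tau_0=1$, $\bar y_0^*=\dot y$, and let $\bar x^0,\bar y^0$ be arbitrary. For $k=0,1,2,\dots$: $$\hat y^k=(1-\tau_k)\bar y^k+\tau_k\bar y_k^*,\qquad \hat x^*_{k+1}\in\arg\min_x\{f(x)+\langle \hat y^k,Ax\rangle+\gamma_{k+1}b_{\mathcal X}(x,\dot x)\},$$ $$\bar y^{k+1}=\mathrm{prox}_{\gamma_{k+1}\bar L_A^{-1}g^*}\big(\hat y^k+\gamma_{k+1}\bar L_A^{-1}A\hat x^*_{k+1}\big),\qquad \bar x^{k+1}=(1-\tau_k)\bar x^k+\tau_k\hat x^*_{k+1},$$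 $$\bar y^*_{k+1}\in\arg\max_y\{\langle A\bar x^{k+1},y\rangle-g^*(y)-\beta_{k+1}b_{\mathcal Y}(y,\dot y)\},$$ where $\tau_{k+1}\in(0,1)$ is the positive root of $\tau^3/L_{b_{\mathcal X}}+\tau^2+\tau_k^2\tau-\tau_k^2=0$, $\gamma_{k+2}=\gamma_{k+1}/(1+\tau_{k+1}/L_{b_{\mathcal X}})$ and $\beta_{k+2}=(1-\tau_{k+1})\beta_{k+1}$. Here $\mathrm{prox}_h(v)$ is a minimizer of $h(u)+\tfrac12\|u-v\|_{\mathcal Y}^2$, and $A\hat x^*_{k+1}$ inside the prox is read as a vector through the inner product $\langle S_{\mathcal Y}\cdot,S_{\mathcal Y}\cdot\rangle$ of $\|\cdot\|_{\mathcal Y}$ (for the Euclidean norm this is the usual formula). **Theorem.** Let $\{\bar x^k\}$ be generated by this algorithm. 1. If $\mathrm{dom}\,g=\mathbb{R}^m$, then for all $x^\star\in\mathcal X^\star$, all $k\ge1$ and all $y^*(\bar x^k)\in\partial g(A\bar x^k)$, $$P(\bar x^k)-P^\star\le\frac{2\gamma_1}{k+1}b_{\mathcal X}(x^\star,\dot x)+\frac{\bar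 L_A}{\gamma_1k}b_{\mathcal Y}(y^*(\bar x^k),\dot y).$$ 2. If $g=\delta_{\{c\}}$ is the indicator function of $\{c\}$, $f^\star=\inf\{f(x):Ax=c\}$, $\mathrm{ri}(\mathrm{dom} f)\cap\{x:Ax=c\}\ne\emptyset$ and $\mathcal X^\star\neq\emptyset$, then $\mathcal Y^\star\ne\emptyset$, and for all $x^\star\in\mathcal X^\star$, $y^\star\in\mathcal Y^\star$ and $k\ge1$, $$f(\bar x^k)-f^\star\ge-\|y^\star\|_{\mathcal Y}\|A\bar x^k-c\|_{\mathcal Y,*},$$ $$f(\bar x^k)-f^\star\le\frac{2\gamma_1}{k+1}b_{\mathcal X}(x^\star,\dot x)+\frac{\bar L_A}{\gamma_1k}b_{\mathcal Y}(y^\star,\dot y)+\|y^\star\|_{\mathcal Y}\|A\bar x^k-c\|_{\mathcal Y,*},$$ $$\|A\bar x^k-c\|_{\mathcal Y,*}\le\frac{\bar L_A}{\gamma_1k}L_{b_{\mathcal Y}}\Big[\|y^\star-\dot y\|_{\mathcal Y}+\Big(\|y^\star-\dot y\|_{\mathcal Y}^2+\frac{4\gamma_1^2}{\bar L_A L_{b_{\mathcal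 Y}}}b_{\mathcal X}(x^\star,\dot x)\Big)^{1/2}\Big].$$ -/

import Mathlib

open scoped InnerProductSpace ENNReal

noncomputable section

namespace ADSGARD

/-- The Euclidean space `ℝⁿ`. -/
abbrev Vec (n : ℕ) : Type := EuclideanSpace ℝ (Fin n)

/-! ### Extended-real-valued convex functions -/

/-- The effective domain of an extended-real-valued function. -/
def effDom {n : ℕ} (h : Vec n → EReal) : Set (Vec n) := {x | h x ≠ ⊤}

/-- Proper, closed (lower semicontinuous) and convex (convex epigraph). -/
structure IsProperClosedConvex {n : ℕ} (h : Vec n → EReal) : Prop where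
  ne_bot : ∀ x, h x ≠ ⊥
  dom_nonempty : (effDom h).Nonempty
  closed : LowerSemicontinuous h
  convex : Convex ℝ {z : Vec n × ℝ | h z.1 ≤ (z.2 : EReal)}

/-- The Fenchel conjugate `h*(y) = sup_x ⟨x, y⟩ - h(x)`. -/
def conj {n : ℕ} (h : Vec n → EReal) (y : Vec n) : EReal :=
  ⨆ x : Vec n, ((⟪x, y⟫_ℝ : ℝ) : EReal) - h x

/-- The subdifferential of `h` at `u`. -/
def subdiff {n : ℕ} (h : Vec n → EReal) (u : Vec n) : Set (Vec n) :=
  {y | ∀ v : Vec n, h u + ((⟪y, v - u⟫_ℝ : ℝ) : EReal) ≤ h v}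

open Classical in
/-- The indicator function of a set: `0` on the set and `+∞` outside. -/
def indicatorFun {n : ℕ} (C : Set (Vec n)) (z : Vec n) : EReal := if z ∈ C then 0 else ⊤

/-! ### The primal and the dual problem -/

/-- The primal objective `P(x) = f(x) + g(Ax)`. -/
def primalObj {n m : ℕ} (f : Vec n → EReal) (g : Vec m → EReal) (A : Vec n →L[ℝ] Vec m)
    (x : Vec n) : EReal :=
  f x + g (A x)

/-- The dual objective `D(y) = -f*(-Aᵀy) - g*(y)`. -/
def dualObj {n m : ℕ} (f : Vec n → EReal) (g : Vec m → EReal) (A : Vec n →L[ℝ] Vec m)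
    (y : Vec m) : EReal :=
  -conj f (-(ContinuousLinearMap.adjoint A y)) - conj g y

/-- The primal optimal value `P*`. -/
def primalVal {n m : ℕ} (f : Vec n → EReal) (g : Vec m → EReal) (A : Vec n →L[ℝ] Vec m) :
    EReal :=
  ⨅ x : Vec n, primalObj f g A x

/-- The optimal value `f*` of `min {f(x) : Ax = c}`. -/
def constrVal {n m : ℕ} (f : Vec n → EReal) (A : Vec n →L[ℝ] Vec m) (c : Vec m) : EReal :=
  ⨅ x ∈ {x : Vec n | A x = c}, f x

/-- The primal solution set. -/
def primalSol {n m : ℕ} (f : Vec n → EReal) (g : Vec m → EReal) (A : Vec n →L[ℝ] Vec m) :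
    Set (Vec n) :=
  {x | IsMinOn (primalObj f g A) Set.univ x}

/-- The dual solution set. -/
def dualSol {n m : ℕ} (f : Vec n → EReal) (g : Vec m → EReal) (A : Vec n →L[ℝ] Vec m) :
    Set (Vec m) :=
  {y | IsMaxOn (dualObj f g A) Set.univ y}

/-! ### Weighted (semi-)norms, prox-functions, Bregman distances

A matrix `S` defines the semi-norm `‖z‖_S = ‖S z‖₂`, a norm when `S` is injective. -/

/-- The dual (semi-)norm `‖u‖_{S,*} = sup {⟨u, v⟩ : ‖v‖_S ≤ 1}`, possibly `+∞` when `S` is not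
injective. -/
def dualNorm {n p : ℕ} (S : Vec n →L[ℝ] Vec p) (u : Vec n) : ℝ≥0∞ :=
  ⨆ (v : Vec n) (_ : ‖S v‖ ≤ 1), ENNReal.ofReal ⟪u, v⟫_ℝ

/-- `‖A‖² = sup {‖Ax‖²_{Y,*} : ‖x‖_X ≤ 1}`, where `‖·‖_X = ‖·‖_{SX}` and `‖·‖_Y = ‖·‖_{SY}`. -/
def opNormSq {n m p q : ℕ} (SX : Vec n →L[ℝ] Vec p) (SY : Vec m →L[ℝ] Vec q)
    (A : Vec n →L[ℝ] Vec m) : ℝ≥0∞ :=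
  ⨆ (x : Vec n) (_ : ‖SX x‖ ≤ 1), dualNorm SY (A x) ^ 2

/-- The constant `L̄_A = ‖A‖²` as a real number (meaningful when `‖A‖²` is finite). -/
def LbarA {n m p q : ℕ} (SX : Vec n →L[ℝ] Vec p) (SY : Vec m →L[ℝ] Vec q)
    (A : Vec n →L[ℝ] Vec m) : ℝ :=
  (opNormSq SX SY A).toReal

/-- Smooth prox-functions: differentiable, `1`-strongly convex with respect to `‖·‖_S`, and with
an `L`-Lipschitz gradient from `‖·‖_S` to `‖·‖_{S,*}`, where `L ≥ 1`. -/
structure IsProxFunction {n p : ℕ} (S : Vec n →L[ℝ] Vec p) (L : ℝ) (d : Vec n → ℝ) : Prop where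
  one_le : 1 ≤ L
  differentiable : Differentiable ℝ d
  strongConvex : ConvexOn ℝ Set.univ (fun z => d z - (1 / 2) * ‖S z‖ ^ 2)
  lipschitz : ∀ z z' : Vec n,
    dualNorm S (gradient d z - gradient d z') ≤ ENNReal.ofReal (L * ‖S (z - z')‖)

/-- The Bregman distance `b(z, z') = d(z) - d(z') - ⟨∇d(z'), z - z'⟩`. -/
def bregman {n : ℕ} (d : Vec n → ℝ) (z z' : Vec n) : ℝ :=
  d z - d z' - ⟪gradient d z', z - z'⟫_ℝ

/-- `u` is a proximal point of `h` at `v` for `‖·‖_S`: a minimizer of `h + (1/2)‖· - v‖_S²`. -/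
def IsProx {n p : ℕ} (S : Vec n →L[ℝ] Vec p) (h : Vec n → EReal) (v u : Vec n) : Prop :=
  IsMinOn (fun w => h w + (((1 / 2) * ‖S (w - v)‖ ^ 2 : ℝ) : EReal)) Set.univ u

/-- `v` is the point "`y + d`", where the functional `d` (a gradient) is read as a vector through
the inner product `⟨Sy, Su⟩` of `‖·‖_S`; that is, `v = y + (SᵀS)⁻¹ d` when `S` is injective, and
literally `v = y + d` for the Euclidean norm. -/
def IsMetricStep {n p : ℕ} (S : Vec n →L[ℝ] Vec p) (y d v : Vec n) : Prop :=
  ∀ u : Vec n, ⟪S (v - y), S u⟫_ℝ = ⟪d, u⟫_ℝ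

/-! ### The algorithm -/

/-- The sequences of the algorithm. The values `γ 0`, `β 0`, `xhat 0` are not used. -/
structure Iterates (n m : ℕ) where
  τ : ℕ → ℝ
  γ : ℕ → ℝ
  β : ℕ → ℝ
  yhat : ℕ → Vec m
  ybar : ℕ → Vec m
  /-- the points `ȳ*_k` -/
  ystar : ℕ → Vec m
  /-- the points `x̂*_k`, `k ≥ 1` -/
  xhat : ℕ → Vec n
  xbar : ℕ → Vec n

/-- `s` is generated by the accelerated dual smoothed gap reduction algorithm. Here `LX` is the
Lipschitz constant of the gradient of the primal prox-function `pX`. -/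
structure IsGenerated {n m p q : ℕ} (f : Vec n → EReal) (g : Vec m → EReal)
    (A : Vec n →L[ℝ] Vec m) (SX : Vec n →L[ℝ] Vec p) (SY : Vec m →L[ℝ] Vec q)
    (pX : Vec n → ℝ) (pY : Vec m → ℝ) (LX : ℝ) (γ₁ : ℝ) (xdot : Vec n) (ydot : Vec m)
    (s : Iterates n m) : Prop where
  τ_zero : s.τ 0 = 1
  τ_mem : ∀ k, s.τ (k + 1) ∈ Set.Ioo (0 : ℝ) 1
  τ_root : ∀ k,
    s.τ (k + 1) ^ 3 / LX + s.τ (k + 1) ^ 2 + s.τ k ^ 2 * s.τ (k + 1) - s.τ k ^ 2 = 0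
  γ_one : s.γ 1 = γ₁
  γ_succ : ∀ k, s.γ (k + 2) = s.γ (k + 1) / (1 + s.τ (k + 1) / LX)
  β_one : s.β 1 = LbarA SX SY A / γ₁
  β_succ : ∀ k, s.β (k + 2) = (1 - s.τ (k + 1)) * s.β (k + 1)
  ystar_zero : s.ystar 0 = ydot
  yhat_eq : ∀ k, s.yhat k = (1 - s.τ k) • s.ybar k + s.τ k • s.ystar k
  /-- `x̂*_{k+1} ∈ argmin_x f(x) + ⟨ŷᵏ, Ax⟩ + γ_{k+1} b_X(x, ẋ)` -/
  xhat_min : ∀ k, IsMinOn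
    (fun x => f x + ((⟪s.yhat k, A x⟫_ℝ + s.γ (k + 1) * bregman pX x xdot : ℝ) : EReal))
    Set.univ (s.xhat (k + 1))
  /-- `ȳᵏ⁺¹ = prox_{ρ g*}(ŷᵏ + ρ A x̂*_{k+1})` with `ρ = γ_{k+1} / L̄_A` -/
  ybar_prox : ∀ k, ∃ v : Vec m,
    IsMetricStep SY (s.yhat k) ((s.γ (k + 1) / LbarA SX SY A) • A (s.xhat (k + 1))) v ∧
    IsProx SY (fun y => ((s.γ (k + 1) / LbarA SX SY A : ℝ) : EReal) * conj g y) v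
      (s.ybar (k + 1))
  xbar_succ : ∀ k, s.xbar (k + 1) = (1 - s.τ k) • s.xbar k + s.τ k • s.xhat (k + 1)
  /-- `ȳ*_{k+1} ∈ argmax_y ⟨Ax̄ᵏ⁺¹, y⟩ - g*(y) - β_{k+1} b_Y(y, ẏ)` -/
  ystar_max : ∀ k, IsMaxOn
    (fun y => ((⟪A (s.xbar (k + 1)), y⟫_ℝ - s.β (k + 1) * bregman pY y ydot : ℝ) : EReal)
      - conj g y)
    Set.univ (s.ystar (k + 1))

end ADSGARD

end

/-! The proof tracks a smoothed duality gap. Adding `γ b_X(·, ẋ)` to the inner primal minimization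
smooths the dual objective; subtracting `β b_Y(·, ẏ)` inside the supremum defining `g` smooths the
primal one. The invariant `IsGenerated.gap_nonpos` says that the smoothed primal value at `x̄ᵏ`
never exceeds the smoothed dual value at `ȳᵏ`. It is stated pointwise, for every primal `x` and dual
`z` of finite value, so neither infimum nor supremum is formed.

The induction tests one step of the method at `y = (1 - τ) ȳ + τ z`. Its error `L̄_A τ² ‖z - ȳ*‖² /
(2γ)` is paid for by the quadratic growth at the old maximizer `ȳ*` (`IsGenerated.ystar_bound`), the
two amounts being equal because `βγ = L̄_A τ²` (`IsGenerated.β_mul_γ`). The decrease of `γ` costs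
nothing, as `(1 - τ)(1 + τ) ≤ 1`. The bound `τ_k ≥ 1/(k+1)` then makes `γ` and `β` decay like `1/k`.

When `g` is finite everywhere, Fenchel–Young turns the invariant into the objective bound. For `Ax =
c`, `g*` is linear and the Slater condition supplies a saddle inequality (`exists_multiplier`,
`dualSol_spec`). Combined with the invariant it yields a quadratic inequality for the dual norm of
the residual. -/

namespace ADSGARD

open Filter Topology

/-! ### Semi-norms and their duals -/

section SemiNorm

variable {n m p q : ℕ}

/-- A bilinear form bounded on the unit balls of two semi-norms is bounded by their product. -/
theorem inner_le_mul_of_unit_bound (SX : Vec n →L[ℝ] Vec p) (SY : Vec m →L[ℝ] Vec q)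
    (A : Vec n →L[ℝ] Vec m) {C : ℝ}
    (h : ∀ x y, ‖SX x‖ ≤ 1 → ‖SY y‖ ≤ 1 → ⟪A x, y⟫_ℝ ≤ C) (x : Vec n) (y : Vec m) :
    ⟪A x, y⟫_ℝ ≤ C * (‖SX x‖ * ‖SY y‖) := by
  -- The semi-norms may vanish at nonzero vectors, so one normalizes by the semi-norm plus `ε` and
  -- lets `ε → 0`.
  have key : ∀ ε : ℝ, 0 < ε → ⟪A x, y⟫_ℝ ≤ C * ((‖SX x‖ + ε) * (‖SY y‖ + ε)) := by
    intro ε hε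
    have ha : 0 < ‖SX x‖ + ε := by positivity
    have hb : 0 < ‖SY y‖ + ε := by positivity
    have := h ((‖SX x‖ + ε)⁻¹ • x) ((‖SY y‖ + ε)⁻¹ • y)
      (by rw [map_smul, norm_smul, Real.norm_of_nonneg (by positivity), inv_mul_le_iff₀ ha]
          linarith)
      (by rw [map_smul, norm_smul, Real.norm_of_nonneg (by positivity), inv_mul_le_iff₀ hb]
          linarith)
    rw [map_smul, real_inner_smul_left, real_inner_smul_right, ← mul_assoc, ← mul_inv,
      inv_mul_le_iff₀ (by positivity)] at this
    linarith
  have hlim : Tendsto (fun ε : ℝ => C * ((‖SX x‖ + ε) * (‖SY y‖ + ε))) (𝓝[>] 0)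
      (𝓝 (C * ((‖SX x‖ + 0) * (‖SY y‖ + 0)))) :=
    ((by fun_prop : Continuous fun ε : ℝ => C * ((‖SX x‖ + ε) * (‖SY y‖ + ε))).tendsto
      0).mono_left nhdsWithin_le_nhds
  have := ge_of_tendsto hlim (eventually_nhdsWithin_of_forall fun ε hε => key ε hε)
  simpa using this

theorem inner_le_of_dualNorm_le (S : Vec n →L[ℝ] Vec p) {u : Vec n} {C : ℝ} (hC : 0 ≤ C)
    (h : dualNorm S u ≤ ENNReal.ofReal C) (v : Vec n) : ⟪u, v⟫_ℝ ≤ C * ‖S v‖ := by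
  have h1 : ∀ w, ‖S w‖ ≤ 1 → ⟪u, w⟫_ℝ ≤ C := fun w hw =>
    (ENNReal.ofReal_le_ofReal_iff hC).1
      ((le_iSup₂ (f := fun (v : Vec n) (_ : ‖S v‖ ≤ 1) => ENNReal.ofReal ⟪u, v⟫_ℝ) w hw).trans h)
  have key : ∀ ε : ℝ, 0 < ε → ⟪u, v⟫_ℝ ≤ C * (‖S v‖ + ε) := by
    intro ε hε
    have ha : 0 < ‖S v‖ + ε := by positivity
    have := h1 ((‖S v‖ + ε)⁻¹ • v)
      (by rw [map_smul, norm_smul, Real.norm_of_nonneg (by positivity), inv_mul_le_iff₀ ha]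
          linarith)
    rw [real_inner_smul_right, inv_mul_le_iff₀ ha] at this
    linarith
  have hlim : Tendsto (fun ε : ℝ => C * (‖S v‖ + ε)) (𝓝[>] 0) (𝓝 (C * (‖S v‖ + 0))) :=
    ((by fun_prop : Continuous fun ε : ℝ => C * (‖S v‖ + ε)).tendsto
      0).mono_left nhdsWithin_le_nhds
  simpa using ge_of_tendsto hlim (eventually_nhdsWithin_of_forall fun ε hε => key ε hε)

theorem dualNorm_le_ofReal (S : Vec n →L[ℝ] Vec p) {u : Vec n} {C : ℝ}
    (h : ∀ v, ‖S v‖ ≤ 1 → ⟪u, v⟫_ℝ ≤ C) : dualNorm S u ≤ ENNReal.ofReal C :=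
  iSup₂_le fun v hv => ENNReal.ofReal_le_ofReal (h v hv)

/-- Generalized Cauchy–Schwarz inequality: on unit balls it is the definition of `L̄_A`, and
homogeneity does the rest. -/
theorem inner_map_le (SX : Vec n →L[ℝ] Vec p) (SY : Vec m →L[ℝ] Vec q)
    (A : Vec n →L[ℝ] Vec m) (hLA : opNormSq SX SY A ≠ ⊤) (x : Vec n) (y : Vec m) :
    ⟪A x, y⟫_ℝ ≤ Real.sqrt (LbarA SX SY A) * (‖SX x‖ * ‖SY y‖) := by
  refine inner_le_mul_of_unit_bound SX SY A (fun x y hx hy => ?_) x y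
  -- `ENNReal.ofReal` truncates negative values to zero, so only a positive pairing may be squared.
  by_cases h0 : ⟪A x, y⟫_ℝ ≤ 0
  · exact h0.trans (Real.sqrt_nonneg _)
  push Not at h0
  refine Real.le_sqrt_of_sq_le ?_
  have h1 : ENNReal.ofReal ⟪A x, y⟫_ℝ ≤ dualNorm SY (A x) :=
    le_iSup₂ (f := fun (v : Vec m) (_ : ‖SY v‖ ≤ 1) => ENNReal.ofReal ⟪A x, v⟫_ℝ) y hy
  have h2 : dualNorm SY (A x) ^ 2 ≤ opNormSq SX SY A :=
    le_iSup₂ (f := fun (x : Vec n) (_ : ‖SX x‖ ≤ 1) => dualNorm SY (A x) ^ 2) x hx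
  have h3 : ENNReal.ofReal (⟪A x, y⟫_ℝ ^ 2) ≤ opNormSq SX SY A := by
    rw [ENNReal.ofReal_pow h0.le]
    exact (pow_le_pow_left' h1 2).trans h2
  exact (ENNReal.ofReal_le_iff_le_toReal hLA).1 h3

theorem LbarA_pos (SX : Vec n →L[ℝ] Vec p) (SY : Vec m →L[ℝ] Vec q)
    (A : Vec n →L[ℝ] Vec m) (hA : A ≠ 0) (hLA : opNormSq SX SY A ≠ ⊤) : 0 < LbarA SX SY A := by
  refine lt_of_le_of_ne ENNReal.toReal_nonneg fun h => hA ?_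
  ext1 x
  have := inner_map_le SX SY A hLA x (A x)
  rw [← h, Real.sqrt_zero, zero_mul] at this
  exact real_inner_self_nonpos.1 this

/-- A dual semi-norm can be infinite when `SY` has a kernel. Finiteness on the range of `A` lets the
residual `A x̄ - c` be measured by a real number. -/
theorem dualNorm_map_ne_top (SX : Vec n →L[ℝ] Vec p) (SY : Vec m →L[ℝ] Vec q)
    (A : Vec n →L[ℝ] Vec m) (hLA : opNormSq SX SY A ≠ ⊤) (x : Vec n) :
    dualNorm SY (A x) ≠ ⊤ := by
  refine ne_top_of_le_ne_top ENNReal.ofReal_ne_top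
    (dualNorm_le_ofReal SY (C := Real.sqrt (LbarA SX SY A) * ‖SX x‖) fun v hv => ?_)
  refine (inner_map_le SX SY A hLA x v).trans ?_
  rw [← mul_assoc]
  exact mul_le_of_le_one_right (by positivity) hv

theorem inner_le_dualNorm_mul (S : Vec n →L[ℝ] Vec p) {u : Vec n} (hu : dualNorm S u ≠ ⊤)
    (v : Vec n) : ⟪u, v⟫_ℝ ≤ (dualNorm S u).toReal * ‖S v‖ :=
  inner_le_of_dualNorm_le S ENNReal.toReal_nonneg (ENNReal.ofReal_toReal hu).ge v

end SemiNorm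

/-! ### Strong convexity and Bregman distances -/

section Bregman

variable {n p : ℕ}

/-- Quadratic growth at a minimizer of a function that is strongly convex for a semi-norm. -/
theorem add_sq_le_of_isMinOn {D : Set (Vec n)} {H : Vec n → ℝ} {S : Vec n →L[ℝ] Vec p} {c : ℝ}
    (hH : ConvexOn ℝ D fun z => H z - c / 2 * ‖S z‖ ^ 2) {a : Vec n} (ha : a ∈ D)
    (hmin : ∀ x ∈ D, H a ≤ H x) {x : Vec n} (hx : x ∈ D) :
    H a + c / 2 * ‖S (x - a)‖ ^ 2 ≤ H x := by
  -- Compare `a` with `(1 - t) a + t x` and divide by `t`; the factor `1 - t` left over disappears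
  -- as `t → 0`.
  have key : ∀ t : ℝ, t ∈ Set.Ioo (0 : ℝ) 1 → H a + c / 2 * (1 - t) * ‖S (x - a)‖ ^ 2 ≤ H x := by
    rintro t ⟨h0, h1⟩
    have hc := hH.2 ha hx (sub_nonneg.2 h1.le) h0.le (by ring)
    have hm := hmin _ (hH.1 ha hx (sub_nonneg.2 h1.le) h0.le (by ring))
    have hn : ‖S ((1 - t) • a + t • x)‖ ^ 2
        = (1 - t) * ‖S a‖ ^ 2 + t * ‖S x‖ ^ 2 - t * (1 - t) * ‖S (x - a)‖ ^ 2 := by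
      rw [map_add, map_smul, map_smul, map_sub, norm_add_sq_real, norm_sub_sq_real, norm_smul,
        norm_smul, real_inner_smul_left, real_inner_smul_right, mul_pow, mul_pow,
        Real.norm_eq_abs, Real.norm_eq_abs, sq_abs, sq_abs, real_inner_comm (S x)]
      ring
    simp only [smul_eq_mul] at hc
    rw [hn] at hc
    have : 0 ≤ t * (H x - (H a + c / 2 * (1 - t) * ‖S (x - a)‖ ^ 2)) := by nlinarith
    linarith [nonneg_of_mul_nonneg_right this h0]
  have hlim : Tendsto (fun t : ℝ => H a + c / 2 * (1 - t) * ‖S (x - a)‖ ^ 2) (𝓝[>] 0)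
      (𝓝 (H a + c / 2 * (1 - 0) * ‖S (x - a)‖ ^ 2)) :=
    ((by fun_prop : Continuous fun t : ℝ => H a + c / 2 * (1 - t) * ‖S (x - a)‖ ^ 2).tendsto
      0).mono_left nhdsWithin_le_nhds
  simpa using le_of_tendsto hlim
    (eventually_of_mem (Ioo_mem_nhdsGT one_pos) key)

theorem convexOn_inner_add (u : Vec n) (r : ℝ) :
    ConvexOn ℝ Set.univ fun z : Vec n => ⟪u, z⟫_ℝ + r :=
  ((innerₗ (Vec n) u).convexOn convex_univ).add_const r

variable {S : Vec n →L[ℝ] Vec p} {L : ℝ} {d : Vec n → ℝ}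

theorem IsProxFunction.convexOn_bregman (hd : IsProxFunction S L d) (z' : Vec n) :
    ConvexOn ℝ Set.univ fun z => bregman d z z' - 1 / 2 * ‖S z‖ ^ 2 := by
  refine (hd.strongConvex.add
    (convexOn_inner_add (-gradient d z') (⟪gradient d z', z'⟫_ℝ - d z'))).congr fun z _ => ?_
  simp only [bregman, inner_sub_right, inner_neg_left, Pi.add_apply]
  ring

theorem IsProxFunction.hasDerivAt_line (hd : IsProxFunction S L d) (z u : Vec n) (t : ℝ) :
    HasDerivAt (fun t : ℝ => d (z + t • u)) ⟪gradient d (z + t • u), u⟫_ℝ t := by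
  have h1 : HasDerivAt (fun t : ℝ => z + t • u) u t := by
    simpa using ((hasDerivAt_id t).smul_const u).const_add z
  have h2 := (hd.differentiable (z + t • u)).hasGradientAt.hasFDerivAt
  exact h2.comp_hasDerivAt t h1

theorem IsProxFunction.bregman_nonneg (hd : IsProxFunction S L d) (z z' : Vec n) :
    0 ≤ bregman d z z' := by
  have hconv : ConvexOn ℝ Set.univ d := by
    have h2 : ConvexOn ℝ Set.univ fun z => (1 / 2 : ℝ) * ‖S z‖ ^ 2 := by
      have h3 : ConvexOn ℝ Set.univ fun z : Vec n => ‖S z‖ ^ 2 := by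
        have := (convexOn_univ_norm (E := Vec p)).comp_linearMap S.toLinearMap
        exact this.pow (fun _ _ => norm_nonneg _) 2
      exact h3.smul (by norm_num)
    refine (hd.strongConvex.add h2).congr fun z _ => ?_
    simp only [Pi.add_apply, sub_add_cancel]
  have hline : ConvexOn ℝ Set.univ fun t : ℝ => d (z' + t • (z - z')) := by
    have := hconv.comp_affineMap (AffineMap.lineMap (k := ℝ) z' z)
    simpa [Function.comp_def, AffineMap.lineMap_apply, add_comm] using this
  have h1 := hline.le_slope_of_hasDerivAt (Set.mem_univ 0) (Set.mem_univ 1) one_pos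
    (hd.hasDerivAt_line z' (z - z') 0)
  rw [slope_def_field, zero_smul, add_zero, one_smul, add_sub_cancel, sub_zero,
    div_one] at h1
  exact sub_nonneg.2 h1

/-- The point `z'` minimizes `b(·, z')`, which is strongly convex, so quadratic growth applies. -/
theorem IsProxFunction.sq_le_bregman (hd : IsProxFunction S L d) (z z' : Vec n) :
    1 / 2 * ‖S (z - z')‖ ^ 2 ≤ bregman d z z' := by
  have h := add_sq_le_of_isMinOn (hd.convexOn_bregman z') (Set.mem_univ z')
    (fun x _ => by
      have : bregman d z' z' = 0 := by simp [bregman]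
      rw [this]; exact hd.bregman_nonneg x z') (Set.mem_univ z)
  have h0 : bregman d z' z' = 0 := by simp [bregman]
  linarith

theorem IsProxFunction.bregman_le (hd : IsProxFunction S L d) (z z' : Vec n) :
    bregman d z z' ≤ L / 2 * ‖S (z - z')‖ ^ 2 := by
  set u := z - z' with hu
  have hL : 0 ≤ L := zero_le_one.trans hd.one_le
  -- Descent lemma: the Lipschitz bound makes this function nonincreasing on `[0, 1]`, and its
  -- endpoint values encode the claim.
  set ψ : ℝ → ℝ := fun t => d (z' + t • u) - t * ⟪gradient d z', u⟫_ℝ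
    - L * ‖S u‖ ^ 2 * (t ^ 2 / 2) with hψ
  have hder : ∀ t, HasDerivAt ψ (⟪gradient d (z' + t • u), u⟫_ℝ - ⟪gradient d z', u⟫_ℝ
      - L * ‖S u‖ ^ 2 * t) t := by
    intro t
    have h1 := (hasDerivAt_id t).mul_const ⟪gradient d z', u⟫_ℝ
    have h2 := (((hasDerivAt_id t).pow 2).div_const 2).const_mul (L * ‖S u‖ ^ 2)
    refine (((hd.hasDerivAt_line z' u t).sub h1).sub h2).congr_deriv ?_
    simp only [id, one_mul]
    ring
  have hanti : AntitoneOn ψ (Set.Icc 0 1) := by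
    refine antitoneOn_of_deriv_nonpos (convex_Icc 0 1)
      (fun t _ => (hder t).continuousAt.continuousWithinAt)
      (fun t _ => (hder t).differentiableAt.differentiableWithinAt) fun t ht => ?_
    rw [interior_Icc] at ht
    rw [(hder t).deriv, ← inner_sub_left]
    have := inner_le_of_dualNorm_le S (by positivity) (hd.lipschitz (z' + t • u) z') u
    rw [add_sub_cancel_left, map_smul, norm_smul, Real.norm_of_nonneg ht.1.le] at this
    nlinarith
  have h01 := hanti (Set.left_mem_Icc.2 zero_le_one) (Set.right_mem_Icc.2 zero_le_one) zero_le_one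
  have hz : z' + u = z := by simp [hu]
  simp only [hψ, zero_smul, one_smul, add_zero, hz] at h01
  simp only [bregman, ← hu]
  linarith

end Bregman

end ADSGARD

namespace ADSGARD

open Filter Topology

/-! ### Extended-real-valued functions through their real values -/

section EReal

variable {n : ℕ}

theorem coe_toReal_of_mem {h : Vec n → EReal} (hb : ∀ x, h x ≠ ⊥) {x : Vec n}
    (hx : x ∈ effDom h) : ((h x).toReal : EReal) = h x :=
  EReal.coe_toReal hx (hb x)

theorem mem_effDom_of_le_coe {h : Vec n → EReal} {x : Vec n} {r : ℝ} (hr : h x ≤ (r : EReal)) :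
    x ∈ effDom h :=
  ne_top_of_le_ne_top (EReal.coe_ne_top r) hr

theorem toReal_le_of_le_coe {h : Vec n → EReal} (hb : ∀ x, h x ≠ ⊥) {x : Vec n} {r : ℝ}
    (hr : h x ≤ (r : EReal)) : (h x).toReal ≤ r := by
  rwa [← coe_toReal_of_mem hb (mem_effDom_of_le_coe hr), EReal.coe_le_coe_iff] at hr

theorem IsProperClosedConvex.convexOn_toReal {h : Vec n → EReal} (hh : IsProperClosedConvex h) :
    ConvexOn ℝ (effDom h) fun x => (h x).toReal := by
  have key : ∀ x ∈ effDom h, ∀ y ∈ effDom h, ∀ a b : ℝ, 0 ≤ a → 0 ≤ b → a + b = 1 →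
      h (a • x + b • y) ≤ ((a * (h x).toReal + b * (h y).toReal : ℝ) : EReal) := by
    intro x hx y hy a b ha hb hab
    have hx' : (x, (h x).toReal) ∈ {z : Vec n × ℝ | h z.1 ≤ (z.2 : EReal)} :=
      (coe_toReal_of_mem hh.ne_bot hx).ge
    have hy' : (y, (h y).toReal) ∈ {z : Vec n × ℝ | h z.1 ≤ (z.2 : EReal)} :=
      (coe_toReal_of_mem hh.ne_bot hy).ge
    exact hh.convex hx' hy' ha hb hab
  exact ⟨fun x hx y hy a b ha hb hab => mem_effDom_of_le_coe (key x hx y hy a b ha hb hab),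
    fun x hx y hy a b ha hb hab =>
      toReal_le_of_le_coe hh.ne_bot (key x hx y hy a b ha hb hab)⟩

/-- Points outside the domain contribute `⊥` to the supremum. Real upper bounds thus describe the
conjugate without extended arithmetic. -/
theorem conj_le_coe_iff {h : Vec n → EReal} (hb : ∀ x, h x ≠ ⊥) {y : Vec n} {r : ℝ} :
    conj h y ≤ (r : EReal) ↔ ∀ x ∈ effDom h, ⟪x, y⟫_ℝ - (h x).toReal ≤ r := by
  refine iSup_le_iff.trans ⟨fun H x hx => ?_, fun H x => ?_⟩
  · have := H x
    rwa [← coe_toReal_of_mem hb hx, ← EReal.coe_sub, EReal.coe_le_coe_iff] at this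
  · by_cases hx : x ∈ effDom h
    · rw [← coe_toReal_of_mem hb hx, ← EReal.coe_sub, EReal.coe_le_coe_iff]
      exact H x hx
    · rw [not_not.1 hx, EReal.sub_top]
      exact bot_le

theorem conj_ne_bot {h : Vec n → EReal} (hb : ∀ x, h x ≠ ⊥) (hd : (effDom h).Nonempty)
    (y : Vec n) : conj h y ≠ ⊥ := by
  obtain ⟨x, hx⟩ := hd
  refine ne_bot_of_le_ne_bot ?_ (le_iSup (fun x => ((⟪x, y⟫_ℝ : ℝ) : EReal) - h x) x)
  rw [← coe_toReal_of_mem hb hx, ← EReal.coe_sub]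
  exact EReal.coe_ne_bot _

/-- The Fenchel–Young inequality. -/
theorem inner_sub_le_toReal_conj {h : Vec n → EReal} (hb : ∀ x, h x ≠ ⊥)
    (hd : (effDom h).Nonempty) {x y : Vec n} (hx : x ∈ effDom h) (hy : y ∈ effDom (conj h)) :
    ⟪x, y⟫_ℝ - (h x).toReal ≤ (conj h y).toReal :=
  (conj_le_coe_iff hb).1 (coe_toReal_of_mem (conj_ne_bot hb hd) hy).ge x hx

theorem convexOn_toReal_conj {h : Vec n → EReal} (hb : ∀ x, h x ≠ ⊥) (hd : (effDom h).Nonempty) :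
    ConvexOn ℝ (effDom (conj h)) fun y => (conj h y).toReal := by
  have key : ∀ x ∈ effDom (conj h), ∀ y ∈ effDom (conj h), ∀ a b : ℝ, 0 ≤ a → 0 ≤ b →
      a + b = 1 → conj h (a • x + b • y) ≤
        ((a * (conj h x).toReal + b * (conj h y).toReal : ℝ) : EReal) := by
    intro x hx y hy a b ha hb' hab
    refine (conj_le_coe_iff hb).2 fun z hz => ?_
    have h1 := mul_le_mul_of_nonneg_left (inner_sub_le_toReal_conj hb hd hz hx) ha
    have h2 := mul_le_mul_of_nonneg_left (inner_sub_le_toReal_conj hb hd hz hy) hb'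
    have h3 : (h z).toReal = a * (h z).toReal + b * (h z).toReal := by rw [← add_mul, hab, one_mul]
    rw [inner_add_right, real_inner_smul_right, real_inner_smul_right]
    linarith
  have hb' := conj_ne_bot hb hd
  exact ⟨fun x hx y hy a b ha hb hab => mem_effDom_of_le_coe (key x hx y hy a b ha hb hab),
    fun x hx y hy a b ha hb hab => toReal_le_of_le_coe hb' (key x hx y hy a b ha hb hab)⟩

/-- A single point of finite value forces the minimizer into the domain, after which everything can
be compared in `ℝ`. -/
theorem toReal_add_le_of_isMinOn {h : Vec n → EReal} (hb : ∀ x, h x ≠ ⊥)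
    (hd : (effDom h).Nonempty) {r : Vec n → ℝ} {a : Vec n}
    (ha : IsMinOn (fun x => h x + (r x : EReal)) Set.univ a) :
    a ∈ effDom h ∧ ∀ x ∈ effDom h, (h a).toReal + r a ≤ (h x).toReal + r x := by
  have hle : ∀ x ∈ effDom h, h a + (r a : EReal) ≤ (((h x).toReal + r x : ℝ) : EReal) := by
    intro x hx
    rw [EReal.coe_add, coe_toReal_of_mem hb hx]
    exact ha (Set.mem_univ x)
  have hmem : a ∈ effDom h := by
    obtain ⟨x, hx⟩ := hd
    intro htop
    have := hle x hx
    rw [htop, EReal.top_add_coe, top_le_iff] at this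
    exact EReal.coe_ne_top _ this
  refine ⟨hmem, fun x hx => ?_⟩
  have := hle x hx
  rwa [← coe_toReal_of_mem hb hmem, ← EReal.coe_add, EReal.coe_le_coe_iff] at this

theorem le_toReal_sub_of_isMaxOn {h : Vec n → EReal} (hb : ∀ x, h x ≠ ⊥)
    (hd : (effDom h).Nonempty) {r : Vec n → ℝ} {a : Vec n}
    (ha : IsMaxOn (fun x => (r x : EReal) - h x) Set.univ a) :
    a ∈ effDom h ∧ ∀ x ∈ effDom h, (h a).toReal + -r a ≤ (h x).toReal + -r x := by
  have hle : ∀ x ∈ effDom h, ((r x - (h x).toReal : ℝ) : EReal) ≤ (r a : EReal) - h a := by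
    intro x hx
    rw [EReal.coe_sub, coe_toReal_of_mem hb hx]
    exact ha (Set.mem_univ x)
  have hmem : a ∈ effDom h := by
    obtain ⟨x, hx⟩ := hd
    intro htop
    have := hle x hx
    rw [htop, EReal.sub_top, le_bot_iff] at this
    exact EReal.coe_ne_bot _ this
  refine ⟨hmem, fun x hx => ?_⟩
  have := hle x hx
  rw [← coe_toReal_of_mem hb hmem, ← EReal.coe_sub, EReal.coe_le_coe_iff] at this
  linarith

theorem coe_mul_ne_bot {h : Vec n → EReal} (hb : ∀ x, h x ≠ ⊥) {ρ : ℝ} (hρ : 0 < ρ) (x : Vec n) :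
    (ρ : EReal) * h x ≠ ⊥ := by
  by_cases hx : x ∈ effDom h
  · rw [← coe_toReal_of_mem hb hx, ← EReal.coe_mul]
    exact EReal.coe_ne_bot _
  · rw [not_not.1 hx, EReal.coe_mul_top_of_pos hρ]
    exact top_ne_bot

theorem effDom_coe_mul {h : Vec n → EReal} (hb : ∀ x, h x ≠ ⊥) {ρ : ℝ} (hρ : 0 < ρ) :
    effDom (fun x => (ρ : EReal) * h x) = effDom h := by
  ext x
  by_cases hx : x ∈ effDom h
  · refine iff_of_true ?_ hx
    show (ρ : EReal) * h x ≠ ⊤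
    rw [← coe_toReal_of_mem hb hx, ← EReal.coe_mul]
    exact EReal.coe_ne_top _
  · refine iff_of_false (fun H => H ?_) hx
    show (ρ : EReal) * h x = ⊤
    rw [not_not.1 hx, EReal.coe_mul_top_of_pos hρ]

end EReal

/-! ### Lagrange multipliers under the Slater condition -/

section Duality

variable {n m : ℕ}

/-- The line from `d` through `x₀` stays in the affine span, where `D` is a neighbourhood of `x₀`;
hence it can be prolonged a little beyond `x₀`. -/
theorem exists_add_smul_sub_mem {D : Set (Vec n)} {x₀ : Vec n} (h₀ : x₀ ∈ intrinsicInterior ℝ D)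
    {d : Vec n} (hd : d ∈ D) : ∃ s : ℝ, 0 < s ∧ x₀ + s • (x₀ - d) ∈ D := by
  obtain ⟨y, hy, rfl⟩ := mem_intrinsicInterior.1 h₀
  have hmem : ∀ t : ℝ, (y : Vec n) + t • ((y : Vec n) - d) ∈ affineSpan ℝ D := by
    intro t
    have := AffineMap.lineMap_mem (-t) y.2 (subset_affineSpan ℝ D hd)
    convert this using 1
    rw [AffineMap.lineMap_apply, vsub_eq_sub, vadd_eq_add, neg_smul, ← smul_neg, neg_sub, add_comm]
  have hcont : Continuous fun t : ℝ =>
      (⟨(y : Vec n) + t • ((y : Vec n) - d), hmem t⟩ : affineSpan ℝ D) :=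
    Continuous.subtype_mk (by fun_prop) _
  have hev : ∀ᶠ t in 𝓝[>] (0 : ℝ), (y : Vec n) + t • ((y : Vec n) - d) ∈ D := by
    have hnhds : ((↑) ⁻¹' D : Set (affineSpan ℝ D)) ∈ 𝓝
        (⟨(y : Vec n) + (0 : ℝ) • ((y : Vec n) - d), hmem 0⟩ : affineSpan ℝ D) := by
      refine mem_interior_iff_mem_nhds.1 ?_
      simpa using hy
    exact ((hcont.tendsto 0).mono_left nhdsWithin_le_nhds).eventually hnhds
  obtain ⟨s, hs, hs0⟩ := (hev.and self_mem_nhdsWithin).exists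
  exact ⟨s, hs0, hs⟩

theorem exists_conic_combination {D : Set (Vec n)} {F : Vec n → ℝ} (hF : ConvexOn ℝ D F)
    {x₁ x₂ : Vec n} (h₁ : x₁ ∈ D) (h₂ : x₂ ∈ D) {r₁ r₂ : ℝ} (hr₁ : 0 ≤ r₁) (hr₂ : 0 ≤ r₂) :
    ∃ x ∈ D, (r₁ + r₂) • x = r₁ • x₁ + r₂ • x₂ ∧ (r₁ + r₂) * F x ≤ r₁ * F x₁ + r₂ * F x₂ := by
  rcases (add_nonneg hr₁ hr₂).eq_or_lt' with h | h
  · have e₁ : r₁ = 0 := by linarith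
    have e₂ : r₂ = 0 := by linarith
    exact ⟨x₁, h₁, by simp [e₁, e₂], by simp [e₁, e₂]⟩
  · have ha : 0 ≤ r₁ / (r₁ + r₂) := by positivity
    have hb : 0 ≤ r₂ / (r₁ + r₂) := by positivity
    have hab : r₁ / (r₁ + r₂) + r₂ / (r₁ + r₂) = 1 := by field_simp
    refine ⟨_, hF.1 h₁ h₂ ha hb hab, ?_, ?_⟩
    · rw [smul_add, smul_smul, smul_smul, mul_div_cancel₀ _ h.ne', mul_div_cancel₀ _ h.ne']
    · refine (mul_le_mul_of_nonneg_left (hF.2 h₁ h₂ ha hb hab) h.le).trans_eq ?_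
      simp only [smul_eq_mul]
      field_simp

/-- The cone generated by the image of a convex set under `x ↦ A x - c`; it is a subspace when
`c` is the image of a point of the relative interior. -/
def slaterSubspace (A : Vec n →L[ℝ] Vec m) (c : Vec m) {D : Set (Vec n)} (hD : Convex ℝ D)
    {x₀ : Vec n} (h₀ : x₀ ∈ intrinsicInterior ℝ D) (hc : A x₀ = c) : Submodule ℝ (Vec m) where
  carrier := {w | ∃ r : ℝ, 0 ≤ r ∧ ∃ x ∈ D, w = r • (A x - c)}
  zero_mem' := ⟨0, le_rfl, x₀, intrinsicInterior_subset h₀, by simp⟩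
  add_mem' := by
    rintro _ _ ⟨r₁, hr₁, x₁, h₁, rfl⟩ ⟨r₂, hr₂, x₂, h₂, rfl⟩
    obtain ⟨x, hx, he, -⟩ :=
      exists_conic_combination (convexOn_const (0 : ℝ) hD) h₁ h₂ hr₁ hr₂
    refine ⟨r₁ + r₂, add_nonneg hr₁ hr₂, x, hx, ?_⟩
    rw [smul_sub (r₁ + r₂), ← map_smul A (r₁ + r₂), he, map_add, map_smul, map_smul]
    module
  smul_mem' := by
    rintro k _ ⟨r, hr, x, hx, rfl⟩
    rcases le_total 0 k with hk | hk
    · exact ⟨k * r, mul_nonneg hk hr, x, hx, by rw [mul_smul]⟩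
    -- Prolonging past `x₀` reverses the sign of `A x - c`, since `A x₀ = c`.
    · obtain ⟨s, hs, hxs⟩ := exists_add_smul_sub_mem h₀ hx
      refine ⟨-k * r / s, div_nonneg (mul_nonneg (neg_nonneg.2 hk) hr) hs.le, _, hxs, ?_⟩
      have : A (x₀ + s • (x₀ - x)) - c = s • -(A x - c) := by
        rw [map_add, map_smul, map_sub, hc]
        module
      rw [this, smul_smul (_ / s), div_mul_cancel₀ _ hs.ne', smul_smul]
      module

/-- Lagrange multipliers for `min {F x : A x = c}` under the Slater condition. -/
theorem exists_multiplier {D : Set (Vec n)} {F : Vec n → ℝ} (hF : ConvexOn ℝ D F)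
    (A : Vec n →L[ℝ] Vec m) (c : Vec m) {x₀ : Vec n} (h₀ : x₀ ∈ intrinsicInterior ℝ D)
    (hc : A x₀ = c) {ρ : ℝ} (hρ : ∀ x ∈ D, A x = c → ρ ≤ F x) :
    ∃ y : Vec m, ∀ x ∈ D, ρ ≤ F x + ⟪y, A x - c⟫_ℝ := by
  set W := slaterSubspace A c hF.1 h₀ hc with hW
  -- The cone over the epigraph of the value function, shifted so that the point `(c, ρ)` sits at
  -- the origin. A functional nonnegative on `K` and equal to `t` at `(0, t)` is a multiplier.
  let K : PointedCone ℝ (W × ℝ) :=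
    { carrier := {z | ∃ r : ℝ, 0 ≤ r ∧ ∃ x ∈ D, (z.1 : Vec m) = r • (A x - c) ∧
        r * (F x - ρ) ≤ z.2}
      zero_mem' := ⟨0, le_rfl, x₀, intrinsicInterior_subset h₀, by simp, by simp⟩
      add_mem' := by
        rintro z₁ z₂ ⟨r₁, hr₁, x₁, h₁, e₁, l₁⟩ ⟨r₂, hr₂, x₂, h₂, e₂, l₂⟩
        obtain ⟨x, hx, he, hl⟩ := exists_conic_combination hF h₁ h₂ hr₁ hr₂
        refine ⟨r₁ + r₂, add_nonneg hr₁ hr₂, x, hx, ?_, ?_⟩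
        · rw [smul_sub, ← map_smul, he, map_add, map_smul, map_smul, Prod.fst_add,
            Submodule.coe_add, e₁, e₂]
          module
        · rw [Prod.snd_add]
          linarith
      smul_mem' := by
        rintro ⟨k, hk⟩ z ⟨r, hr, x, hx, e, l⟩
        refine ⟨k * r, mul_nonneg hk hr, x, hx, ?_, ?_⟩
        · show k • (z.1 : Vec m) = _
          rw [e, mul_smul]
        · show _ ≤ k * z.2
          rw [mul_assoc]
          exact mul_le_mul_of_nonneg_left l hk }
  let φ : W × ℝ →ₗ.[ℝ] ℝ :=
    ⟨Submodule.prod ⊥ ⊤, (LinearMap.snd ℝ W ℝ).domRestrict _⟩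
  obtain ⟨g, hg, hgK⟩ := riesz_extension K φ
    (by
      rintro ⟨z, hz⟩ ⟨r, hr, x, hx, e, l⟩
      have hz1 : z.1 = 0 := (Submodule.mem_bot ℝ).1 hz.1
      rw [hz1, Submodule.coe_zero] at e
      show 0 ≤ z.2
      refine le_trans ?_ l
      rcases smul_eq_zero.1 e.symm with h | h
      · rw [h, zero_mul]
      · exact mul_nonneg hr (sub_nonneg.2 (hρ x hx (sub_eq_zero.1 h))))
    -- Cofinality: working in `W` rather than in the whole space guarantees that some point of `K`
    -- lies above every `w`.
    (by
      rintro ⟨⟨w, r, hr, x, hx, hw⟩, t⟩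
      refine ⟨⟨(0, r * (F x - ρ) - t), ⟨Submodule.zero_mem _, trivial⟩⟩, r, hr, x, hx, ?_, ?_⟩
      · simpa using hw
      · simp)
  let ℓ : W →L[ℝ] ℝ := LinearMap.toContinuousLinearMap (g.comp (LinearMap.inl ℝ W ℝ))
  refine ⟨((InnerProductSpace.toDual ℝ W).symm ℓ : W), fun x hx => ?_⟩
  have hxW : A x - c ∈ W := ⟨1, zero_le_one, x, hx, (one_smul _ _).symm⟩
  have h1 : ⟪(((InnerProductSpace.toDual ℝ W).symm ℓ : W) : Vec m), A x - c⟫_ℝ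
      = g (⟨A x - c, hxW⟩, 0) :=
    InnerProductSpace.toDual_symm_apply (x := (⟨A x - c, hxW⟩ : W)) (y := ℓ)
  have h2 : 0 ≤ g (⟨A x - c, hxW⟩, F x - ρ) :=
    hgK _ ⟨1, zero_le_one, x, hx, (one_smul _ _).symm, (one_mul _).le⟩
  have h3 : g (0, F x - ρ) = F x - ρ :=
    hg ⟨(0, F x - ρ), ⟨Submodule.zero_mem _, trivial⟩⟩
  have h4 : g (⟨A x - c, hxW⟩, F x - ρ) = g (⟨A x - c, hxW⟩, 0) + g (0, F x - ρ) := by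
    rw [← map_add, Prod.mk_add_mk, add_zero, zero_add]
  rw [h1]
  linarith

end Duality

end ADSGARD

namespace ADSGARD

/-! ### The parameter sequences -/

section Parameters

variable {n m p q : ℕ} {f : Vec n → EReal} {g : Vec m → EReal}
  {A : Vec n →L[ℝ] Vec m} {SX : Vec n →L[ℝ] Vec p} {SY : Vec m →L[ℝ] Vec q}
  {pX : Vec n → ℝ} {pY : Vec m → ℝ} {γ₁ : ℝ} {xdot : Vec n} {ydot : Vec m} {s : Iterates n m}

theorem IsGenerated.τ_pos (hs : IsGenerated f g A SX SY pX pY 1 γ₁ xdot ydot s) (k : ℕ) :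
    0 < s.τ k := by
  cases k with
  | zero => rw [hs.τ_zero]; exact one_pos
  | succ k => exact (hs.τ_mem k).1

theorem IsGenerated.τ_rec (hs : IsGenerated f g A SX SY pX pY 1 γ₁ xdot ydot s) (k : ℕ) :
    s.τ (k + 1) ^ 2 * (1 + s.τ (k + 1)) = s.τ k ^ 2 * (1 - s.τ (k + 1)) := by
  have := hs.τ_root k
  rw [div_one] at this
  linarith

/-- If `(k + 2) t < 1` for `t = τ_{k+1}`, then `(k + 1) t < 1 - t`, and the recursion gives `1 - t <
(1 - t)(1 - t²)`, which is absurd. -/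
theorem IsGenerated.inv_le_τ (hs : IsGenerated f g A SX SY pX pY 1 γ₁ xdot ydot s) (k : ℕ) :
    1 ≤ (k + 1) * s.τ k := by
  induction k with
  | zero => simp [hs.τ_zero]
  | succ k ih =>
    by_contra! hlt
    push_cast at hlt
    set t := s.τ (k + 1)
    have ht : 0 < t := hs.τ_pos (k + 1)
    have hk : (0 : ℝ) ≤ k := Nat.cast_nonneg k
    have hrec := hs.τ_rec k
    have h1 : (1 : ℝ) ≤ (k + 1) ^ 2 * s.τ k ^ 2 := by
      rw [← mul_pow]; exact one_le_pow₀ ih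
    have hlt' : (k + 1) * t < 1 - t := by linarith
    have ht1 : 0 < 1 - t := lt_trans (by positivity) hlt'
    have h2 : 1 - t ≤ (k + 1) ^ 2 * t ^ 2 * (1 + t) := by
      calc 1 - t ≤ (k + 1) ^ 2 * s.τ k ^ 2 * (1 - t) := le_mul_of_one_le_left ht1.le h1
        _ = (k + 1) ^ 2 * t ^ 2 * (1 + t) := by rw [mul_assoc, ← hrec]; ring
    have h3 : (k + 1) ^ 2 * t ^ 2 < (1 - t) ^ 2 := by
      rw [← mul_pow]; exact pow_lt_pow_left₀ hlt' (by positivity) two_ne_zero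
    have h4 : (k + 1) ^ 2 * t ^ 2 * (1 + t) < (1 - t) ^ 2 * (1 + t) :=
      mul_lt_mul_of_pos_right h3 (by linarith)
    have h5 : (1 - t) ^ 2 * (1 + t) = (1 - t) * (1 - t ^ 2) := by ring
    nlinarith [mul_pos ht1 (pow_pos ht 2)]

theorem IsGenerated.γ_pos (hs : IsGenerated f g A SX SY pX pY 1 γ₁ xdot ydot s) (hγ : 0 < γ₁)
    (k : ℕ) : 0 < s.γ (k + 1) := by
  induction k with
  | zero => rw [hs.γ_one]; exact hγ
  | succ k ih =>
    rw [hs.γ_succ, div_one]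
    exact div_pos ih (by linarith [hs.τ_pos (k + 1)])

theorem IsGenerated.γ_rec (hs : IsGenerated f g A SX SY pX pY 1 γ₁ xdot ydot s) (k : ℕ) :
    s.γ (k + 1) = (1 + s.τ (k + 1)) * s.γ (k + 2) := by
  have : (1 + s.τ (k + 1)) ≠ 0 := by linarith [hs.τ_pos (k + 1)]
  rw [hs.γ_succ, div_one, mul_div_cancel₀ _ this]

/-- The cubic for `τ` is exactly the condition under which this relation survives the updates of `β`
and `γ`. -/
theorem IsGenerated.β_mul_γ (hs : IsGenerated f g A SX SY pX pY 1 γ₁ xdot ydot s) (hγ : 0 < γ₁)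
    (k : ℕ) : s.β (k + 1) * s.γ (k + 1) = LbarA SX SY A * s.τ k ^ 2 := by
  induction k with
  | zero => rw [hs.β_one, hs.γ_one, hs.τ_zero]; field_simp
  | succ k ih =>
    have hτ : (1 + s.τ (k + 1)) ≠ 0 := by linarith [hs.τ_pos (k + 1)]
    apply mul_left_cancel₀ hτ
    calc (1 + s.τ (k + 1)) * (s.β (k + 2) * s.γ (k + 2))
        = (1 - s.τ (k + 1)) * (s.β (k + 1) * ((1 + s.τ (k + 1)) * s.γ (k + 2))) := by
          rw [hs.β_succ]; ring
      _ = LbarA SX SY A * (s.τ k ^ 2 * (1 - s.τ (k + 1))) := by rw [← hs.γ_rec, ih]; ring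
      _ = (1 + s.τ (k + 1)) * (LbarA SX SY A * s.τ (k + 1) ^ 2) := by rw [← hs.τ_rec]; ring

theorem IsGenerated.β_pos (hs : IsGenerated f g A SX SY pX pY 1 γ₁ xdot ydot s) (hγ : 0 < γ₁)
    (hL : 0 < LbarA SX SY A) (k : ℕ) : 0 < s.β (k + 1) := by
  refine pos_of_mul_pos_left (b := s.γ (k + 1)) ?_ (hs.γ_pos hγ k).le
  rw [hs.β_mul_γ hγ]
  exact mul_pos hL (pow_pos (hs.τ_pos k) 2)

theorem IsGenerated.γ_le (hs : IsGenerated f g A SX SY pX pY 1 γ₁ xdot ydot s) (hγ : 0 < γ₁)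
    (k : ℕ) : (k + 2) * s.γ (k + 1) ≤ 2 * γ₁ := by
  induction k with
  | zero => rw [hs.γ_one]; simp
  | succ k ih =>
    have hτ := hs.inv_le_τ (k + 1)
    have hp := hs.γ_pos hγ (k + 1)
    rw [hs.γ_rec] at ih
    push_cast at hτ ⊢
    -- It remains to see `k + 3 ≤ (k + 2)(1 + τ_{k+1})`, which is the lower bound on `τ_{k+1}`.
    refine le_trans ?_ ih
    rw [← mul_assoc]
    refine mul_le_mul_of_nonneg_right ?_ hp.le
    linarith

theorem IsGenerated.β_le (hs : IsGenerated f g A SX SY pX pY 1 γ₁ xdot ydot s) (hγ : 0 < γ₁)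
    (hL : 0 < LbarA SX SY A) (k : ℕ) : (k + 1) * s.β (k + 1) ≤ LbarA SX SY A / γ₁ := by
  induction k with
  | zero => rw [hs.β_one]; simp
  | succ k ih =>
    have hτ := hs.inv_le_τ (k + 1)
    have hp := hs.β_pos hγ hL k
    rw [hs.β_succ]
    push_cast at hτ ⊢
    refine le_trans ?_ ih
    rw [← mul_assoc]
    refine mul_le_mul_of_nonneg_right ?_ hp.le
    linarith

end Parameters

/-! ### The smoothed gap -/

section Gap

variable {n m p q : ℕ} {f : Vec n → EReal} {g : Vec m → EReal}
  {A : Vec n →L[ℝ] Vec m} {SX : Vec n →L[ℝ] Vec p} {SY : Vec m →L[ℝ] Vec q}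
  {pX : Vec n → ℝ} {pY : Vec m → ℝ} {LY γ₁ : ℝ} {xdot : Vec n} {ydot : Vec m}
  {s : Iterates n m}

/-- Both smoothed subproblems have this shape; the Bregman term supplies strong convexity of modulus
`c`. -/
theorem convexOn_add_bregman {p : ℕ} {S : Vec n →L[ℝ] Vec p} {L c : ℝ} {d F : Vec n → ℝ}
    {D : Set (Vec n)} (hF : ConvexOn ℝ D F) (hd : IsProxFunction S L d) (hc : 0 ≤ c) (u z' : Vec n) :
    ConvexOn ℝ D fun z => F z + (⟪u, z⟫_ℝ + c * bregman d z z') - c / 2 * ‖S z‖ ^ 2 := by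
  refine ((hF.add ((convexOn_inner_add u 0).subset (Set.subset_univ D) hF.1)).add
    (((hd.convexOn_bregman z').smul hc).subset (Set.subset_univ D) hF.1)).congr fun z _ => ?_
  simp only [Pi.add_apply, smul_eq_mul]
  ring

/-- The primal step: lower bound for the smoothed Lagrangian. -/
theorem IsGenerated.primal_step (hs : IsGenerated f g A SX SY pX pY 1 γ₁ xdot ydot s)
    (hf : IsProperClosedConvex f) (hLA : opNormSq SX SY A ≠ ⊤) (hpX : IsProxFunction SX 1 pX)
    (hγ : 0 < γ₁) (k : ℕ) :
    s.xhat (k + 1) ∈ effDom f ∧ ∀ x ∈ effDom f, ∀ y : Vec m,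
      (f (s.xhat (k + 1))).toReal + ⟪y, A (s.xhat (k + 1))⟫_ℝ
          + s.γ (k + 1) * bregman pX (s.xhat (k + 1)) xdot
          - LbarA SX SY A / (2 * s.γ (k + 1)) * ‖SY (y - s.yhat k)‖ ^ 2
        ≤ (f x).toReal + ⟪y, A x⟫_ℝ + s.γ (k + 1) * bregman pX x xdot := by
  obtain ⟨hmem, hmin⟩ := toReal_add_le_of_isMinOn hf.ne_bot hf.dom_nonempty (hs.xhat_min k)
  refine ⟨hmem, fun x hx y => ?_⟩
  have hγk := hs.γ_pos hγ k
  set γ := s.γ (k + 1)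
  set xh := s.xhat (k + 1)
  have hadj : ∀ z, ⟪ContinuousLinearMap.adjoint A (s.yhat k), z⟫_ℝ = ⟪s.yhat k, A z⟫_ℝ :=
    fun z => ContinuousLinearMap.adjoint_inner_left A z (s.yhat k)
  have hconv := convexOn_add_bregman hf.convexOn_toReal hpX hγk.le
    (ContinuousLinearMap.adjoint A (s.yhat k)) xdot
  simp only [hadj] at hconv
  have hq := add_sq_le_of_isMinOn hconv hmem hmin hx
  have hb := inner_map_le SX SY A hLA (xh - x) (y - s.yhat k)
  have hL : 0 ≤ LbarA SX SY A := ENNReal.toReal_nonneg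
  have hsq := Real.sq_sqrt hL
  have hnorm : ‖SX (xh - x)‖ = ‖SX (x - xh)‖ := by
    rw [← neg_sub, map_neg, norm_neg]
  rw [hnorm] at hb
  -- Young's inequality, weighted so that the `x`-part is exactly the quadratic growth of the primal
  -- subproblem.
  have hyoung : Real.sqrt (LbarA SX SY A) * (‖SX (x - xh)‖ * ‖SY (y - s.yhat k)‖)
      ≤ γ / 2 * ‖SX (x - xh)‖ ^ 2 + LbarA SX SY A / (2 * γ) * ‖SY (y - s.yhat k)‖ ^ 2 := by
    have h := div_nonneg (sq_nonneg (γ * ‖SX (x - xh)‖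
      - Real.sqrt (LbarA SX SY A) * ‖SY (y - s.yhat k)‖)) (by positivity : 0 ≤ 2 * γ)
    have e : (γ * ‖SX (x - xh)‖ - Real.sqrt (LbarA SX SY A) * ‖SY (y - s.yhat k)‖) ^ 2 / (2 * γ)
        = γ / 2 * ‖SX (x - xh)‖ ^ 2
          + Real.sqrt (LbarA SX SY A) ^ 2 / (2 * γ) * ‖SY (y - s.yhat k)‖ ^ 2
          - Real.sqrt (LbarA SX SY A) * (‖SX (x - xh)‖ * ‖SY (y - s.yhat k)‖) := by
      field_simp
      ring
    rw [e, hsq] at h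
    linarith
  rw [map_sub, real_inner_comm, inner_sub_left, inner_sub_right, inner_sub_right] at hb
  linarith

/-- The dual step: the proximal step maximizes a quadratic model of the dual function. -/
theorem IsGenerated.dual_step (hs : IsGenerated f g A SX SY pX pY 1 γ₁ xdot ydot s)
    (hg : IsProperClosedConvex g) (hg' : (effDom (conj g)).Nonempty) (hL : 0 < LbarA SX SY A)
    (hγ : 0 < γ₁) (k : ℕ) :
    s.ybar (k + 1) ∈ effDom (conj g) ∧ ∀ y ∈ effDom (conj g),
      ⟪y, A (s.xhat (k + 1))⟫_ℝ - (conj g y).toReal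
          - LbarA SX SY A / (2 * s.γ (k + 1)) * ‖SY (y - s.yhat k)‖ ^ 2
        ≤ ⟪s.ybar (k + 1), A (s.xhat (k + 1))⟫_ℝ - (conj g (s.ybar (k + 1))).toReal
          - LbarA SX SY A / (2 * s.γ (k + 1)) * ‖SY (s.ybar (k + 1) - s.yhat k)‖ ^ 2 := by
  obtain ⟨v, hv, hprox⟩ := hs.ybar_prox k
  have hγk := hs.γ_pos hγ k
  set γ := s.γ (k + 1)
  set Lb := LbarA SX SY A
  set yh := s.yhat k
  have hρ : 0 < γ / Lb := div_pos hγk hL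
  have hb := conj_ne_bot hg.ne_bot hg.dom_nonempty
  have hdom := effDom_coe_mul hb hρ
  obtain ⟨hmem, hmin⟩ := toReal_add_le_of_isMinOn (coe_mul_ne_bot hb hρ) (hdom ▸ hg') hprox
  rw [hdom] at hmem hmin
  refine ⟨hmem, fun y hy => ?_⟩
  -- Expanding the prox square around `ŷᵏ`: the metric step turns the cross term into the pairing
  -- with `A x̂*`.
  have hexp : ∀ w : Vec m, 1 / 2 * ‖SY (w - v)‖ ^ 2 = 1 / 2 * ‖SY (w - yh)‖ ^ 2
      - γ / Lb * (⟪w, A (s.xhat (k + 1))⟫_ℝ - ⟪yh, A (s.xhat (k + 1))⟫_ℝ)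
      + 1 / 2 * ‖SY (v - yh)‖ ^ 2 := by
    intro w
    have h1 : SY (w - v) = SY (w - yh) - SY (v - yh) := by
      rw [← map_sub, sub_sub_sub_cancel_right]
    have h2 := hv (w - yh)
    rw [real_inner_smul_left, real_inner_comm, real_inner_comm _ (A _), inner_sub_left] at h2
    rw [h1, norm_sub_sq_real, h2]
    ring
  have h := hmin y hy
  simp only [EReal.toReal_mul, EReal.toReal_coe] at h
  rw [hexp, hexp] at h
  have h' := mul_le_mul_of_nonneg_left h (div_pos hL hγk).le
  have e : ∀ a b c d : ℝ, Lb / γ * (γ / Lb * a + (1 / 2 * b - γ / Lb * c + d))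
      = a + Lb / (2 * γ) * b - c + Lb / γ * d := by
    intro a b c d
    field_simp
    ring
  rw [e, e] at h'
  linarith

/-- The dual averaging point, with quadratic growth. -/
theorem IsGenerated.ystar_bound (hs : IsGenerated f g A SX SY pX pY 1 γ₁ xdot ydot s)
    (hg : IsProperClosedConvex g) (hg' : (effDom (conj g)).Nonempty) (hL : 0 < LbarA SX SY A)
    (hpY : IsProxFunction SY LY pY) (hγ : 0 < γ₁) (k : ℕ) :
    s.ystar (k + 1) ∈ effDom (conj g) ∧ ∀ y ∈ effDom (conj g),
      ⟪A (s.xbar (k + 1)), y⟫_ℝ - (conj g y).toReal - s.β (k + 1) * bregman pY y ydot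
          + s.β (k + 1) / 2 * ‖SY (y - s.ystar (k + 1))‖ ^ 2
        ≤ ⟪A (s.xbar (k + 1)), s.ystar (k + 1)⟫_ℝ - (conj g (s.ystar (k + 1))).toReal
          - s.β (k + 1) * bregman pY (s.ystar (k + 1)) ydot := by
  have hb := conj_ne_bot hg.ne_bot hg.dom_nonempty
  obtain ⟨hmem, hmin⟩ := le_toReal_sub_of_isMaxOn hb hg' (hs.ystar_max k)
  refine ⟨hmem, fun y hy => ?_⟩
  have hconv := convexOn_add_bregman (convexOn_toReal_conj hg.ne_bot hg.dom_nonempty) hpY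
    (hs.β_pos hγ hL k).le (-A (s.xbar (k + 1))) ydot
  have hq := add_sq_le_of_isMinOn hconv hmem (fun x hx => by
    have := hmin x hx
    rw [inner_neg_left, inner_neg_left]
    linarith) hy
  rw [inner_neg_left, inner_neg_left] at hq
  linarith

/-- One step of the method, in terms of an arbitrary comparison point of the dual. -/
theorem IsGenerated.one_step (hs : IsGenerated f g A SX SY pX pY 1 γ₁ xdot ydot s)
    (hf : IsProperClosedConvex f) (hg : IsProperClosedConvex g)
    (hg' : (effDom (conj g)).Nonempty) (hLA : opNormSq SX SY A ≠ ⊤) (hL : 0 < LbarA SX SY A)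
    (hpX : IsProxFunction SX 1 pX) (hγ : 0 < γ₁) (k : ℕ) {x : Vec n} (hx : x ∈ effDom f)
    {y : Vec m} (hy : y ∈ effDom (conj g)) :
    (f (s.xhat (k + 1))).toReal + ⟪y, A (s.xhat (k + 1))⟫_ℝ - (conj g y).toReal
        + s.γ (k + 1) * bregman pX (s.xhat (k + 1)) xdot
        - LbarA SX SY A / (2 * s.γ (k + 1)) * ‖SY (y - s.yhat k)‖ ^ 2
      ≤ (f x).toReal + ⟪s.ybar (k + 1), A x⟫_ℝ + s.γ (k + 1) * bregman pX x xdot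
        - (conj g (s.ybar (k + 1))).toReal := by
  -- With the comparison point `ȳᵏ⁺¹`, the quadratic penalty is the one appearing in the dual step,
  -- and the two cancel.
  have h1 := (hs.primal_step hf hLA hpX hγ k).2 x hx (s.ybar (k + 1))
  have h2 := (hs.dual_step hg hg' hL hγ k).2 y hy
  linarith

/-- The smoothed gap of the iterates is nonpositive. -/
theorem IsGenerated.gap_nonpos (hs : IsGenerated f g A SX SY pX pY 1 γ₁ xdot ydot s)
    (hf : IsProperClosedConvex f) (hg : IsProperClosedConvex g)
    (hg' : (effDom (conj g)).Nonempty) (hLA : opNormSq SX SY A ≠ ⊤) (hL : 0 < LbarA SX SY A)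
    (hpX : IsProxFunction SX 1 pX) (hpY : IsProxFunction SY LY pY) (hγ : 0 < γ₁) (k : ℕ) :
    s.xbar (k + 1) ∈ effDom f ∧ ∀ x ∈ effDom f, ∀ z ∈ effDom (conj g),
      (f (s.xbar (k + 1))).toReal + ⟪A (s.xbar (k + 1)), z⟫_ℝ - (conj g z).toReal
          - s.β (k + 1) * bregman pY z ydot
        ≤ (f x).toReal + ⟪s.ybar (k + 1), A x⟫_ℝ + s.γ (k + 1) * bregman pX x xdot
          - (conj g (s.ybar (k + 1))).toReal := by
  induction k with
  | zero =>
    have hxh := (hs.primal_step hf hLA hpX hγ 0).1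
    have hxb : s.xbar (0 + 1) = s.xhat (0 + 1) := by
      rw [hs.xbar_succ, hs.τ_zero, sub_self, zero_smul, zero_add, one_smul]
    have hyh : s.yhat 0 = ydot := by
      rw [hs.yhat_eq, hs.τ_zero, sub_self, zero_smul, zero_add, one_smul, hs.ystar_zero]
    rw [hxb]
    refine ⟨hxh, fun x hx z hz => ?_⟩
    have h1 := hs.one_step hf hg hg' hLA hL hpX hγ 0 hx hz
    have h2 := mul_nonneg (hs.γ_pos hγ 0).le (hpX.bregman_nonneg (s.xhat (0 + 1)) xdot)
    have h3 := mul_le_mul_of_nonneg_left (hpY.sq_le_bregman z ydot) (hs.β_pos hγ hL 0).le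
    -- Since `β₁ = L̄_A / γ₁`, the penalty is `β₁ ‖z - ẏ‖² / 2`, which `β₁ b_Y(z, ẏ)` dominates.
    have h4 : LbarA SX SY A / (2 * s.γ (0 + 1)) = s.β (0 + 1) * (1 / 2) := by
      rw [zero_add, hs.β_one, hs.γ_one]
      field_simp
    rw [hyh, h4] at h1
    rw [real_inner_comm]
    linarith
  | succ k ih =>
    obtain ⟨hxb, ih⟩ := ih
    have hxh := (hs.primal_step hf hLA hpX hγ (k + 1)).1
    have hyb := (hs.dual_step hg hg' hL hγ k).1
    obtain ⟨hys, hysb⟩ := hs.ystar_bound hg hg' hL hpY hγ k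
    obtain ⟨hτ0, hτ1⟩ := hs.τ_mem k
    have hconvF := hf.convexOn_toReal
    have hconvG := convexOn_toReal_conj hg.ne_bot hg.dom_nonempty
    have hγ2 := hs.γ_pos hγ (k + 1)
    have hβγ := hs.β_mul_γ hγ (k + 1)
    have hγrec := hs.γ_rec k
    have hβ := hs.β_succ k
    have hxeq := hs.xbar_succ (k + 1)
    have hyeq := hs.yhat_eq (k + 1)
    set τ := s.τ (k + 1)
    set xh := s.xhat (k + 1 + 1)
    have hτ1' : 0 ≤ 1 - τ := sub_nonneg.2 hτ1.le
    have hFx := hconvF.2 hxb hxh hτ1' hτ0.le (by ring)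
    simp only [smul_eq_mul] at hFx
    rw [← hxeq] at hFx
    refine ⟨by rw [hxeq]; exact hconvF.1 hxb hxh hτ1' hτ0.le (by ring), fun x hx z hz => ?_⟩
    have hy := hconvG.1 hyb hz hτ1' hτ0.le (by ring)
    have hGy := hconvG.2 hyb hz hτ1' hτ0.le (by ring)
    simp only [smul_eq_mul] at hGy
    have hstep := hs.one_step hf hg hg' hLA hL hpX hγ (k + 1) hx hy
    have hdiff : (1 - τ) • s.ybar (k + 1) + τ • z - s.yhat (k + 1)
        = τ • (z - s.ystar (k + 1)) := by
      rw [hyeq]; module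
    -- The step error equals `1 - τ` times the quadratic growth at `ȳ*_{k+1}`, by the invariant for
    -- `βγ`.
    have hcoef : LbarA SX SY A / (2 * s.γ (k + 1 + 1)) * (τ ^ 2 * ‖SY (z - s.ystar (k + 1))‖ ^ 2)
        = (1 - τ) * (s.β (k + 1) / 2 * ‖SY (z - s.ystar (k + 1))‖ ^ 2) := by
      have : LbarA SX SY A * τ ^ 2 / s.γ (k + 1 + 1) = (1 - τ) * s.β (k + 1) := by
        rw [← hβ, ← hβγ, mul_div_cancel_right₀ _ hγ2.ne']
      calc _ = (LbarA SX SY A * τ ^ 2 / s.γ (k + 1 + 1))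
            * (1 / 2 * ‖SY (z - s.ystar (k + 1))‖ ^ 2) := by field_simp
        _ = _ := by rw [this]; ring
    rw [hdiff, map_smul, norm_smul, mul_pow, Real.norm_eq_abs, sq_abs, hcoef, inner_add_left,
      real_inner_smul_left, real_inner_smul_left] at hstep
    -- The previous gap is tested at the new `x̂*` and the old `ȳ*`, with the growth term kept on
    -- the left.
    have hprev := mul_le_mul_of_nonneg_left
      ((add_le_add_left (hysb z hz) (f (s.xbar (k + 1))).toReal).trans
        ((by linarith : _ ≤ _).trans (ih xh hxh _ hys))) hτ1'
    -- The surplus from `(1 - τ)(1 + τ) γ = γ - τ² γ`.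
    have hbx := mul_nonneg (mul_nonneg hγ2.le (hpX.bregman_nonneg xh xdot)) (sq_nonneg τ)
    have hAx : ⟪A (s.xbar (k + 1 + 1)), z⟫_ℝ
        = (1 - τ) * ⟪A (s.xbar (k + 1)), z⟫_ℝ + τ * ⟪z, A xh⟫_ℝ := by
      rw [hxeq, map_add, map_smul, map_smul, inner_add_left, real_inner_smul_left,
        real_inner_smul_left, real_inner_comm z (A xh)]
    rw [hAx, hβ]
    rw [hγrec] at hprev
    linarith

end Gap

end ADSGARD

namespace ADSGARD

/-! ### Primal and dual solutions -/

section Solutions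

variable {n m : ℕ} {f : Vec n → EReal} {g : Vec m → EReal} {A : Vec n →L[ℝ] Vec m}

theorem primalVal_eq {x : Vec n} (hx : x ∈ primalSol f g A) :
    primalVal f g A = primalObj f g A x :=
  le_antisymm (iInf_le _ x) (le_iInf fun z => hx (Set.mem_univ z))

/-- The equality case of Fenchel–Young, in the direction that needs a subgradient. -/
theorem toReal_conj_le_of_mem_subdiff (hg : IsProperClosedConvex g) {u y : Vec m}
    (hu : u ∈ effDom g) (hy : y ∈ subdiff g u) :
    y ∈ effDom (conj g) ∧ (conj g y).toReal ≤ ⟪u, y⟫_ℝ - (g u).toReal := by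
  have h : conj g y ≤ ((⟪u, y⟫_ℝ - (g u).toReal : ℝ) : EReal) := by
    refine (conj_le_coe_iff hg.ne_bot).2 fun x hx => ?_
    have := hy x
    rw [← coe_toReal_of_mem hg.ne_bot hu, ← coe_toReal_of_mem hg.ne_bot hx, ← EReal.coe_add,
      EReal.coe_le_coe_iff, inner_sub_right, real_inner_comm, real_inner_comm u] at this
    linarith
  exact ⟨mem_effDom_of_le_coe h, toReal_le_of_le_coe (conj_ne_bot hg.ne_bot hg.dom_nonempty) h⟩

theorem effDom_indicatorFun (C : Set (Vec m)) : effDom (indicatorFun C) = C := by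
  ext x
  by_cases hx : x ∈ C <;> simp [effDom, indicatorFun, hx]

theorem indicatorFun_ne_bot (C : Set (Vec m)) (x : Vec m) : indicatorFun C x ≠ ⊥ := by
  by_cases hx : x ∈ C <;> simp [indicatorFun, hx]

theorem conj_indicatorFun_singleton (c y : Vec m) :
    conj (indicatorFun {c}) y = ((⟪c, y⟫_ℝ : ℝ) : EReal) := by
  refine le_antisymm ((conj_le_coe_iff (indicatorFun_ne_bot _)).2 fun x hx => ?_) ?_
  · rw [effDom_indicatorFun, Set.mem_singleton_iff] at hx
    simp [hx, indicatorFun]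
  · refine le_trans ?_ (le_iSup _ c)
    simp [indicatorFun]

theorem primalObj_indicatorFun {c : Vec m} {x : Vec n} (hx : A x = c) :
    primalObj f (indicatorFun {c}) A x = f x := by
  simp [primalObj, indicatorFun, hx]

theorem mem_of_mem_primalSol (hf : IsProperClosedConvex f) {c : Vec m} {x₀ x : Vec n}
    (h₀ : x₀ ∈ effDom f) (hc : A x₀ = c) (hx : x ∈ primalSol f (indicatorFun {c}) A) :
    A x = c ∧ x ∈ effDom f ∧ constrVal f A c = f x := by
  have h := hx (Set.mem_univ x₀)
  have hA : A x = c := by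
    by_contra hne
    have h' : primalObj f (indicatorFun {c}) A x ≤ primalObj f (indicatorFun {c}) A x₀ := h
    rw [primalObj_indicatorFun hc] at h'
    have : primalObj f (indicatorFun {c}) A x = ⊤ := by
      simp [primalObj, indicatorFun, hne, EReal.add_top_of_ne_bot (hf.ne_bot x)]
    rw [this, top_le_iff] at h'
    exact h₀ h'
  have hmin : ∀ z, A z = c → f x ≤ f z := fun z hz => by
    have := hx (Set.mem_univ z)
    rwa [← primalObj_indicatorFun (f := f) hA, ← primalObj_indicatorFun (f := f) hz]
  exact ⟨hA, ne_top_of_le_ne_top h₀ (hmin x₀ hc),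
    le_antisymm (iInf₂_le x hA) (le_iInf₂ fun z hz => hmin z hz)⟩

/-- As `g*` is `⟨c, ·⟩`, the dual objective is the infimum of the Lagrangian over `dom f`; it is
described through its real lower bounds. -/
theorem coe_le_dualObj_iff (hf : IsProperClosedConvex f) {c y : Vec m} {r : ℝ} :
    (r : EReal) ≤ dualObj f (indicatorFun {c}) A y ↔
      ∀ x ∈ effDom f, r ≤ (f x).toReal + ⟪y, A x - c⟫_ℝ := by
  have h1 : (r : EReal) ≤ dualObj f (indicatorFun {c}) A y ↔
      conj f (-(ContinuousLinearMap.adjoint A y)) ≤ ((-r - ⟪c, y⟫_ℝ : ℝ) : EReal) := by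
    rw [dualObj, conj_indicatorFun_singleton]
    induction conj f (-(ContinuousLinearMap.adjoint A y)) with
    | bot => simp
    | top => simp [-EReal.coe_sub]
    | coe a =>
      rw [← EReal.coe_neg, ← EReal.coe_sub, EReal.coe_le_coe_iff, EReal.coe_le_coe_iff]
      constructor <;> intro h <;> linarith
  rw [h1, conj_le_coe_iff hf.ne_bot]
  refine forall₂_congr fun x _ => ?_
  rw [inner_neg_right, ContinuousLinearMap.adjoint_inner_right, inner_sub_right,
    real_inner_comm (A x) y, real_inner_comm c y]
  constructor <;> intro h <;> linarith

/-- Strong duality for `min {f x : A x = c}` under the Slater condition. -/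
theorem dualSol_spec (hf : IsProperClosedConvex f) {c : Vec m} {x₀ x : Vec n}
    (h₀ : x₀ ∈ intrinsicInterior ℝ (effDom f)) (hc : A x₀ = c)
    (hx : x ∈ primalSol f (indicatorFun {c}) A) :
    (dualSol f (indicatorFun {c}) A).Nonempty ∧ ∀ y ∈ dualSol f (indicatorFun {c}) A,
      ∀ z ∈ effDom f, (f x).toReal ≤ (f z).toReal + ⟪y, A z - c⟫_ℝ := by
  obtain ⟨hA, hmem, hval⟩ := mem_of_mem_primalSol hf (intrinsicInterior_subset h₀) hc hx
  obtain ⟨y₀, hy₀⟩ := exists_multiplier hf.convexOn_toReal A c h₀ hc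
    (ρ := (f x).toReal) fun z hz hz' => by
      have : f x ≤ f z := hval ▸ iInf₂_le z hz'
      rwa [← coe_toReal_of_mem hf.ne_bot hmem, ← coe_toReal_of_mem hf.ne_bot hz,
        EReal.coe_le_coe_iff] at this
  have hy₀' := (coe_le_dualObj_iff hf).2 hy₀
  refine ⟨⟨y₀, fun y _ => ?_⟩, fun y hy => (coe_le_dualObj_iff hf).1
    (hy₀'.trans (hy (Set.mem_univ y₀)))⟩
  refine le_trans ?_ hy₀'
  -- Weak duality: a real number strictly between `f x` and the dual value contradicts the
  -- Lagrangian bound at the feasible point `x`.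
  by_contra! hlt
  obtain ⟨r, hr1, hr2⟩ := EReal.lt_iff_exists_real_btwn.1 hlt
  have := (coe_le_dualObj_iff hf).1 hr2.le x hmem
  rw [hA, sub_self, inner_zero_right, add_zero] at this
  exact absurd (EReal.coe_lt_coe_iff.1 hr1) this.not_gt

end Solutions

/-! ### Convergence rates -/

/-- The largest value allowed by a quadratic inequality. -/
theorem le_mul_add_sqrt {R b Δ E : ℝ} (hb : 0 < b) (h : R ^ 2 ≤ 2 * b * (E + R * Δ)) :
    R ≤ b * (Δ + Real.sqrt (Δ ^ 2 + 2 * E / b)) := by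
  have h1 : (R / b - Δ) ^ 2 ≤ Δ ^ 2 + 2 * E / b := by
    have e : (R / b - Δ) ^ 2 = Δ ^ 2 + (R ^ 2 - 2 * b * (R * Δ)) / b ^ 2 := by
      field_simp
      ring
    have e' : 2 * E / b = (2 * b * E) / b ^ 2 := by field_simp
    rw [e, e']
    gcongr
    linarith
  have h2 := Real.le_sqrt_of_sq_le h1
  have h3 : R / b ≤ Δ + Real.sqrt (Δ ^ 2 + 2 * E / b) := by linarith
  rwa [div_le_iff₀' hb] at h3

section Rates

variable {n m p q : ℕ} {f : Vec n → EReal} {g : Vec m → EReal}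
  {A : Vec n →L[ℝ] Vec m} {SX : Vec n →L[ℝ] Vec p} {SY : Vec m →L[ℝ] Vec q}
  {pX : Vec n → ℝ} {pY : Vec m → ℝ} {LY γ₁ : ℝ} {xdot : Vec n} {ydot : Vec m}
  {s : Iterates n m}

theorem IsGenerated.γ_le_div (hs : IsGenerated f g A SX SY pX pY 1 γ₁ xdot ydot s) (hγ : 0 < γ₁)
    (k : ℕ) : s.γ (k + 1) ≤ 2 * γ₁ / ((k + 1 : ℕ) + 1) := by
  rw [le_div_iff₀' (by positivity)]
  have := hs.γ_le hγ k
  push_cast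
  linarith

theorem IsGenerated.β_le_div (hs : IsGenerated f g A SX SY pX pY 1 γ₁ xdot ydot s) (hγ : 0 < γ₁)
    (hL : 0 < LbarA SX SY A) (k : ℕ) : s.β (k + 1) ≤ LbarA SX SY A / (γ₁ * (k + 1 : ℕ)) := by
  rw [← div_div, le_div_iff₀' (by positivity)]
  have := hs.β_le hγ hL k
  push_cast
  linarith

/-- The rate when `dom g` is the whole space. -/
theorem IsGenerated.primalObj_sub_le (hs : IsGenerated f g A SX SY pX pY 1 γ₁ xdot ydot s)
    (hf : IsProperClosedConvex f) (hg : IsProperClosedConvex g) (hLA : opNormSq SX SY A ≠ ⊤)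
    (hL : 0 < LbarA SX SY A) (hpX : IsProxFunction SX 1 pX) (hpY : IsProxFunction SY LY pY)
    (hγ : 0 < γ₁) (hdom : effDom g = Set.univ) {x : Vec n} (hx : x ∈ primalSol f g A) (k : ℕ)
    {y : Vec m} (hy : y ∈ subdiff g (A (s.xbar (k + 1)))) :
    primalObj f g A (s.xbar (k + 1)) - primalVal f g A ≤
      ((2 * γ₁ / ((k + 1 : ℕ) + 1) * bregman pX x xdot
        + LbarA SX SY A / (γ₁ * (k + 1 : ℕ)) * bregman pY y ydot : ℝ) : EReal) := by
  have hgd : ∀ u, u ∈ effDom g := fun u => hdom ▸ Set.mem_univ u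
  obtain ⟨hyd, hyc⟩ := toReal_conj_le_of_mem_subdiff hg (hgd _) hy
  have hg' : (effDom (conj g)).Nonempty := ⟨y, hyd⟩
  obtain ⟨hxb, hgap⟩ := hs.gap_nonpos hf hg hg' hLA hL hpX hpY hγ k
  have hxd : x ∈ effDom f := by
    intro htop
    have h : primalObj f g A x ≤ primalObj f g A (s.xbar (k + 1)) := hx (Set.mem_univ _)
    rw [primalObj, htop, EReal.top_add_of_ne_bot (hg.ne_bot _), top_le_iff, primalObj,
      ← coe_toReal_of_mem hf.ne_bot hxb, ← coe_toReal_of_mem hg.ne_bot (hgd _),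
      ← EReal.coe_add] at h
    exact EReal.coe_ne_top _ h
  have h1 := hgap x hxd y hyd
  -- Fenchel–Young at `A x⋆` and `ȳᵏ⁺¹` replaces the dual terms of the gap by `g(A x⋆)`.
  have h2 := inner_sub_le_toReal_conj hg.ne_bot hg.dom_nonempty (hgd (A x))
    (hs.dual_step hg hg' hL hγ k).1
  have h3 := mul_le_mul_of_nonneg_right (hs.γ_le_div hγ k) (hpX.bregman_nonneg x xdot)
  have h4 := mul_le_mul_of_nonneg_right (hs.β_le_div hγ hL k) (hpY.bregman_nonneg y ydot)
  rw [primalVal_eq hx, primalObj, primalObj, ← coe_toReal_of_mem hf.ne_bot hxb,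
    ← coe_toReal_of_mem hf.ne_bot hxd, ← coe_toReal_of_mem hg.ne_bot (hgd (A x)),
    ← coe_toReal_of_mem hg.ne_bot (hgd (A (s.xbar (k + 1)))), ← EReal.coe_add, ← EReal.coe_add,
    ← EReal.coe_sub, EReal.coe_le_coe_iff]
  rw [real_inner_comm] at h2
  linarith

/-- The rates for the equality-constrained problem. -/
theorem IsGenerated.constrained_rates {c : Vec m}
    (hs : IsGenerated f (indicatorFun {c}) A SX SY pX pY 1 γ₁ xdot ydot s)
    (hf : IsProperClosedConvex f) (hg : IsProperClosedConvex (indicatorFun {c}))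
    (hLA : opNormSq SX SY A ≠ ⊤) (hL : 0 < LbarA SX SY A)
    (hpX : IsProxFunction SX 1 pX) (hpY : IsProxFunction SY LY pY) (hγ : 0 < γ₁)
    {x : Vec n} (hxA : A x = c) (hxd : x ∈ effDom f) {y : Vec m}
    (hsaddle : ∀ z ∈ effDom f, (f x).toReal ≤ (f z).toReal + ⟪y, A z - c⟫_ℝ) (k : ℕ) :
    s.xbar (k + 1) ∈ effDom f ∧
    -(‖SY y‖ * (dualNorm SY (A (s.xbar (k + 1)) - c)).toReal)
      ≤ (f (s.xbar (k + 1))).toReal - (f x).toReal ∧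
    (f (s.xbar (k + 1))).toReal - (f x).toReal ≤
      2 * γ₁ / ((k + 1 : ℕ) + 1) * bregman pX x xdot
        + LbarA SX SY A / (γ₁ * (k + 1 : ℕ)) * bregman pY y ydot
        + ‖SY y‖ * (dualNorm SY (A (s.xbar (k + 1)) - c)).toReal ∧
    dualNorm SY (A (s.xbar (k + 1)) - c) ≤
      ENNReal.ofReal (LbarA SX SY A / (γ₁ * (k + 1 : ℕ)) * LY *
        (‖SY (y - ydot)‖ + Real.sqrt (‖SY (y - ydot)‖ ^ 2
          + 4 * γ₁ ^ 2 / (LbarA SX SY A * LY) * bregman pX x xdot))) := by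
  have hcd : ∀ z, z ∈ effDom (conj (indicatorFun {c})) := fun z => by
    show conj (indicatorFun {c}) z ≠ ⊤
    rw [conj_indicatorFun_singleton]
    exact EReal.coe_ne_top _
  obtain ⟨hxb, hgap⟩ := hs.gap_nonpos hf hg ⟨0, hcd 0⟩ hLA hL hpX hpY hγ k
  have hγk := hs.γ_le_div hγ k
  have hβk := hs.β_le_div hγ hL k
  have hβ0 := hs.β_pos hγ hL k
  have hγ0 := hs.γ_pos hγ k
  set xb := s.xbar (k + 1)
  set γ := s.γ (k + 1)
  set β := s.β (k + 1)
  set r := A xb - c with hr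
  set Δ := ‖SY (y - ydot)‖
  set E := γ * bregman pX x xdot with hE
  have hE0 : 0 ≤ E := mul_nonneg hγ0.le (hpX.bregman_nonneg x xdot)
  have hgap' : ∀ z, (f xb).toReal - (f x).toReal + ⟪r, z⟫_ℝ - β * bregman pY z ydot ≤ E := by
    intro z
    have h := hgap x hxd z (hcd z)
    rw [conj_indicatorFun_singleton, conj_indicatorFun_singleton, EReal.toReal_coe,
      EReal.toReal_coe, hxA, real_inner_comm] at h
    rw [hr, inner_sub_left, real_inner_comm]
    rw [real_inner_comm (s.ybar (k + 1)) c] at h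
    linarith
  have hrtop : dualNorm SY r ≠ ⊤ := by
    have : r = A (xb - x) := by rw [hr, map_sub, hxA]
    rw [this]
    exact dualNorm_map_ne_top SX SY A hLA _
  have hinner := inner_le_dualNorm_mul SY hrtop
  set R := (dualNorm SY r).toReal with hR
  have hR0 : 0 ≤ R := ENNReal.toReal_nonneg
  have hlow := hsaddle xb hxb
  rw [← hr, real_inner_comm] at hlow
  have hry := hinner y
  have hry' := hinner (-y)
  rw [inner_neg_right, map_neg, norm_neg] at hry'
  have h3 := mul_le_mul_of_nonneg_right hγk (hpX.bregman_nonneg x xdot)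
  have h4 := mul_le_mul_of_nonneg_right hβk (hpY.bregman_nonneg y ydot)
  refine ⟨hxb, by linarith, by linarith [hgap' y], ?_⟩
  have hLY : 0 < LY := one_pos.trans_le hpY.one_le
  have hbL : 0 < β * LY := mul_pos hβ0 hLY
  have hrΔ := hinner (y - ydot)
  have hsq : ∀ v, ‖SY v‖ ≤ 1 → ⟪r, v⟫_ℝ ^ 2 ≤ 2 * (β * LY) * (E + R * Δ) := by
    intro v hv
    -- This `t` maximizes `t ⟨r, v⟩ - β LY t² / 2`, the lower bound obtained from the test point `ẏ
    -- + t v`.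
    set t := ⟪r, v⟫_ℝ / (β * LY) with ht
    have h1 := hgap' (ydot + t • v)
    have h2 := hpY.bregman_le (ydot + t • v) ydot
    rw [add_sub_cancel_left, map_smul, norm_smul, mul_pow, Real.norm_eq_abs, sq_abs] at h2
    have h5 : LY / 2 * (t ^ 2 * ‖SY v‖ ^ 2) ≤ LY / 2 * t ^ 2 := by
      refine mul_le_mul_of_nonneg_left ?_ (by positivity)
      exact mul_le_of_le_one_right (sq_nonneg t) (pow_le_one₀ (norm_nonneg _) hv)
    have h6 := mul_le_mul_of_nonneg_left (h2.trans h5) hβ0.le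
    rw [inner_add_right, real_inner_smul_right] at h1
    rw [inner_sub_right] at hrΔ
    have hcomb : t * ⟪r, v⟫_ℝ - β * (LY / 2 * t ^ 2) ≤ E + R * Δ := by linarith
    have e : t * ⟪r, v⟫_ℝ - β * (LY / 2 * t ^ 2) = ⟪r, v⟫_ℝ ^ 2 / (2 * (β * LY)) := by
      rw [ht]
      field_simp
      ring
    rwa [e, div_le_iff₀' (by positivity)] at hcomb
  have hQ : 0 ≤ 2 * (β * LY) * (E + R * Δ) := by positivity
  have hRsq : R ^ 2 ≤ 2 * (β * LY) * (E + R * Δ) := by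
    have h1 : dualNorm SY r ≤ ENNReal.ofReal (Real.sqrt (2 * (β * LY) * (E + R * Δ))) :=
      dualNorm_le_ofReal SY fun v hv => Real.le_sqrt_of_sq_le (hsq v hv)
    have h2 := ENNReal.toReal_le_of_le_ofReal (Real.sqrt_nonneg _) h1
    exact (Real.le_sqrt hR0 hQ).1 h2
  rw [← ENNReal.ofReal_toReal hrtop]
  refine ENNReal.ofReal_le_ofReal ?_
  set B := LbarA SX SY A / (γ₁ * (k + 1 : ℕ)) with hB
  have hB0 : 0 < B := hβ0.trans_le hβk
  have hBsq : R ^ 2 ≤ 2 * (B * LY) * (E + R * Δ) :=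
    hRsq.trans (by gcongr)
  refine (le_mul_add_sqrt (by positivity : 0 < B * LY) hBsq).trans ?_
  gcongr
  -- Relaxing the denominator by one makes the iteration index cancel under the square root.
  have hγ' : γ ≤ 2 * γ₁ / (k + 1 : ℕ) :=
    hγk.trans (div_le_div_of_nonneg_left (by positivity) (by positivity) (by linarith))
  have e : 4 * γ₁ ^ 2 / (LbarA SX SY A * LY) * bregman pX x xdot
      = 2 * (2 * γ₁ / (k + 1 : ℕ) * bregman pX x xdot) / (B * LY) := by
    rw [hB]
    field_simp
    ring
  rw [e, hE]
  have hbn := hpX.bregman_nonneg x xdot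
  gcongr

end Rates

end ADSGARD

theorem mainTheorem2 {n m p q : ℕ}
    (f : ADSGARD.Vec n → EReal) (g : ADSGARD.Vec m → EReal)
    (hf : ADSGARD.IsProperClosedConvex f) (hg : ADSGARD.IsProperClosedConvex g)
    (A : ADSGARD.Vec n →L[ℝ] ADSGARD.Vec m) (hA : A ≠ 0)
    (SX : ADSGARD.Vec n →L[ℝ] ADSGARD.Vec p) (SY : ADSGARD.Vec m →L[ℝ] ADSGARD.Vec q)
    (hLA : ADSGARD.opNormSq SX SY A ≠ ⊤)
    (pX : ADSGARD.Vec n → ℝ) (pY : ADSGARD.Vec m → ℝ) (LY : ℝ)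
    (hpX : ADSGARD.IsProxFunction SX 1 pX) (hpY : ADSGARD.IsProxFunction SY LY pY)
    (γ₁ : ℝ) (hγ₁ : 0 < γ₁) (xdot : ADSGARD.Vec n) (ydot : ADSGARD.Vec m)
    (s : ADSGARD.Iterates n m)
    (hs : ADSGARD.IsGenerated f g A SX SY pX pY 1 γ₁ xdot ydot s) :
    -- the case `dom g = ℝᵐ`
    (ADSGARD.effDom g = Set.univ →
      ∀ xstar ∈ ADSGARD.primalSol f g A, ∀ k : ℕ, 1 ≤ k →
      ∀ y ∈ ADSGARD.subdiff g (A (s.xbar k)),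
        ADSGARD.primalObj f g A (s.xbar k) - ADSGARD.primalVal f g A ≤
          ((2 * γ₁ / (k + 1) * ADSGARD.bregman pX xstar xdot
            + ADSGARD.LbarA SX SY A / (γ₁ * k) * ADSGARD.bregman pY y ydot : ℝ) : EReal)) ∧
    -- the case `g = δ_{c}`, under the Slater condition
    (∀ c : ADSGARD.Vec m, g = ADSGARD.indicatorFun {c} →
      (intrinsicInterior ℝ (ADSGARD.effDom f) ∩ {x | A x = c}).Nonempty →
      ∀ xstar ∈ ADSGARD.primalSol f g A,
      (ADSGARD.dualSol f g A).Nonempty ∧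
      ∀ ystar ∈ ADSGARD.dualSol f g A, ∀ k : ℕ, 1 ≤ k →
        ((-(‖SY ystar‖ * (ADSGARD.dualNorm SY (A (s.xbar k) - c)).toReal) : ℝ) : EReal) ≤
          f (s.xbar k) - ADSGARD.constrVal f A c ∧
        f (s.xbar k) - ADSGARD.constrVal f A c ≤
          ((2 * γ₁ / (k + 1) * ADSGARD.bregman pX xstar xdot
            + ADSGARD.LbarA SX SY A / (γ₁ * k) * ADSGARD.bregman pY ystar ydot
            + ‖SY ystar‖ * (ADSGARD.dualNorm SY (A (s.xbar k) - c)).toReal : ℝ) : EReal) ∧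
        ADSGARD.dualNorm SY (A (s.xbar k) - c) ≤
          ENNReal.ofReal (ADSGARD.LbarA SX SY A / (γ₁ * k) * LY *
            (‖SY (ystar - ydot)‖ + Real.sqrt (‖SY (ystar - ydot)‖ ^ 2
              + 4 * γ₁ ^ 2 / (ADSGARD.LbarA SX SY A * LY)
                * ADSGARD.bregman pX xstar xdot)))) := by
  have hL := ADSGARD.LbarA_pos SX SY A hA hLA
  refine ⟨fun hdom x hx k hk y hy => ?_, fun c hc hslater x hx => ?_⟩
  · obtain ⟨k, rfl⟩ := Nat.exists_eq_add_of_le' hk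
    exact hs.primalObj_sub_le hf hg hLA hL hpX hpY hγ₁ hdom hx k hy
  · subst hc
    obtain ⟨x₀, h₀, hc₀⟩ := hslater
    obtain ⟨hxA, hxd, hval⟩ :=
      ADSGARD.mem_of_mem_primalSol hf (intrinsicInterior_subset h₀) hc₀ hx
    obtain ⟨hne, hsol⟩ := ADSGARD.dualSol_spec hf h₀ hc₀ hx
    refine ⟨hne, fun y hy k hk => ?_⟩
    -- The rates are proved at index `k + 1`; both function values are finite there, so the extended
    -- differences become real.
    obtain ⟨k, rfl⟩ := Nat.exists_eq_add_of_le' hk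
    obtain ⟨hxb, h1, h2, h3⟩ :=
      hs.constrained_rates hf hg hLA hL hpX hpY hγ₁ hxA hxd (hsol y hy) k
    rw [hval, ← ADSGARD.coe_toReal_of_mem hf.ne_bot hxb,
      ← ADSGARD.coe_toReal_of_mem hf.ne_bot hxd, ← EReal.coe_sub, EReal.coe_le_coe_iff,
      EReal.coe_le_coe_iff]
    exact ⟨h1, h2, h3⟩
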